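/- Let $\mu$ be normalized arc length (Haar probability measure) on the unit circle $\mathbb{T}$, let $\lambda$ be a Borel probability measure on $\mathbb{T}$ with $\lambda\ll\mu$ and $\mu\ll\lambda$, and put $g=d\lambda/d\mu$. Let $1\le p<\infty$ and let $H^p(\mu)$ denote the closure in $L^p(\mu)$ (complex-valued functions) of the polynomials in $z$. Let $W$ be a closed linear subspace of $L^p(\lambda)$ with $zW\subseteq W$. Then $g^{1/p}W=\chi_E L^p(\mu)$ for some Borel set $E\subseteq\mathbb{T}$, or $g^{1/p}W=\varphi H^p(\mu)$ for some unimodular function $\varphi$, that is, a measurable $\varphi:\mathbb{T}\to\mathbb{C}$ with $|\varphi|=1$ $\mu$-almost everywhere. -/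

import Mathlib

open MeasureTheory Polynomial
open scoped ENNReal

noncomputable section

namespace HardyCircle

/-- The Borel σ-algebra of the unit circle. -/
instance instMeasurableSpaceCircle : MeasurableSpace Circle := borel Circle

instance instBorelSpaceCircle : BorelSpace Circle := ⟨rfl⟩

/-- Normalized arc length (Haar probability measure) on the unit circle. -/
def arc : Measure Circle := Measure.haarMeasure ⊤

/-- The set `w S = {w f : f ∈ S}` for a set `S` of elements of `L^p(ν)`, as a set of classes of
functions modulo equality `μ`-almost everywhere. It is used with `μ ≪ ν`, so that the class of
`w f` does not depend on the representative of `f`. -/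
def mulImage {p : ℝ≥0∞} {ν : Measure Circle} (μ : Measure Circle) (w : Circle → ℂ)
    (S : Set (Lp ℂ p ν)) : Set (Circle →ₘ[μ] ℂ) :=
  {h | ∃ f ∈ S, ∀ᵐ z ∂μ, h z = w z * f z}

/-- `z W ⊆ W`: with every `f`, the set `W` contains the function `z ↦ z f(z)`. -/
def ZInvariant {p : ℝ≥0∞} {ν : Measure Circle} (W : Set (Lp ℂ p ν)) : Prop :=
  ∀ f ∈ W, ∃ h ∈ W, ∀ᵐ z ∂ν, h z = (z : ℂ) * f z

/-- The Hardy space `H^p(ν)`: the closure in `L^p(ν)` of the polynomials in `z`. -/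
def hardy (p : ℝ≥0∞) [Fact (1 ≤ p)] (ν : Measure Circle) : Set (Lp ℂ p ν) :=
  closure {f : Lp ℂ p ν | ∃ P : ℂ[X], ∀ᵐ z ∂ν, f z = P.eval (z : ℂ)}

/-- A unimodular function: a measurable function of modulus one almost everywhere. -/
def Unimodular (φ : Circle → ℂ) : Prop :=
  Measurable φ ∧ ∀ᵐ z ∂arc, ‖φ z‖ = 1

/-- The function `g^{1/p}`, where `g = dν/dμ` with `μ` normalized arc length. -/
def densityRoot (p : ℝ≥0∞) (ν : Measure Circle) (z : Circle) : ℂ :=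
  (((ν.rnDeriv arc z).toReal ^ (1 / p.toReal) : ℝ) : ℂ)

end HardyCircle

end

noncomputable section

namespace HardyCircle

open Filter Topology ComplexConjugate

-- Multiplication by `g^{1/p}` is an isometry of `L^p(λ)` onto `L^p(μ)` that commutes with
-- multiplication by `z`, so it is enough to classify the closed `z`-invariant subspaces `M` of
-- `L^p(μ)`.
--
-- For `p = 2` this is the argument of Wiener, Beurling and Helson (`invariant_subspace_two`). If
-- `zK = K`, orthogonality to `K` is a pointwise condition, and the projection of `1` to `K` has the
-- required support `E`. Otherwise some nonzero `r ∈ K` is orthogonal to `zK`. All Fourier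
-- coefficients of `|r|²` except the mean vanish, so `r` is a multiple of a unimodular `φ`, and
-- uniqueness of Fourier coefficients gives `K = φH²`.
--
-- Other exponents are compared with the `L²`-closure `K` of `M ∩ L²`. The bridge is
-- `exists_truncating_multipliers`. For integrable `F ≥ 0` the function `u = log⁺(F/(n+1))` is in
-- `L²`, hence is the real part of an analytic `q`, and `k = exp(-q)` satisfies `|k| ≤ 1` and `|k|F
-- ≤ n+1`, with `k → 1` along a subsequence. Being obtained from polynomials by bounded limits, `k`
-- maps `M` into itself. With `F = |f|`, each `f ∈ M` is a dominated limit of bounded elements of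
-- `M`. With `F = ∑|f_n - g| + |g|`, each `g ∈ K ∩ L^p` is in `M`. So `M` and `K` contain the same
-- bounded functions, these determine `M`, and the same holds for `H^p` and `H²`.

instance instIsProbabilityMeasureArc : IsProbabilityMeasure arc :=
  ⟨by simpa [arc] using Measure.haarMeasure_self (G := Circle) (K₀ := ⊤)⟩

instance instIsMulLeftInvariantArc : arc.IsMulLeftInvariant := by
  unfold arc; infer_instance

-- Trigonometric polynomials and uniqueness of Fourier coefficients

/-- The monomial `z ↦ z ^ n`, with an integer exponent, as a continuous function. -/
def monomialMap (n : ℤ) : C(Circle, ℂ) where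
  toFun z := ((z ^ n : Circle) : ℂ)
  continuous_toFun := continuous_induced_dom.comp (continuous_zpow n)

theorem monomialMap_apply (n : ℤ) (z : Circle) : monomialMap n z = (z : ℂ) ^ n := by
  simp [monomialMap]

theorem conj_zpow_circle (n : ℤ) (z : Circle) : conj ((z : ℂ) ^ n) = (z : ℂ) ^ (-n) := by
  rw [map_zpow₀, ← Circle.coe_inv_eq_conj, Circle.coe_inv, inv_zpow, zpow_neg]

/-- The star subalgebra of trigonometric polynomials. -/
def trigSubalgebra : StarSubalgebra ℂ C(Circle, ℂ) where
  toSubalgebra := Algebra.adjoin ℂ (Set.range monomialMap)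
  star_mem' := by
    change Algebra.adjoin ℂ (Set.range monomialMap) ≤
      star (Algebra.adjoin ℂ (Set.range monomialMap))
    refine Algebra.adjoin_le ?_
    rintro - ⟨n, rfl⟩
    refine Algebra.subset_adjoin ⟨-n, ContinuousMap.ext fun z => ?_⟩
    simp only [ContinuousMap.star_apply, monomialMap_apply]
    exact (conj_zpow_circle n z).symm

theorem trigSubalgebra_coe :
    Subalgebra.toSubmodule trigSubalgebra.toSubalgebra =
      Submodule.span ℂ (Set.range monomialMap) := by
  apply Algebra.adjoin_eq_span_of_subset
  refine Set.Subset.trans ?_ Submodule.subset_span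
  intro x hx
  refine Submonoid.closure_induction (fun _ => id) ⟨0, ?_⟩ ?_ hx
  · ext1 z; simp [monomialMap_apply]
  · rintro - - - - ⟨m, rfl⟩ ⟨n, rfl⟩
    refine ⟨m + n, ?_⟩
    ext1 z
    simp [monomialMap_apply, zpow_add₀ (Circle.coe_ne_zero z)]

theorem trigSubalgebra_separatesPoints : trigSubalgebra.SeparatesPoints := by
  intro x y hxy
  refine ⟨_, ⟨monomialMap 1, Algebra.subset_adjoin ⟨1, rfl⟩, rfl⟩, ?_⟩
  simpa [monomialMap_apply] using fun h => hxy (Circle.ext h)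

/-- Trigonometric polynomials are uniformly dense in the continuous functions. -/
theorem span_monomialMap_closure :
    (Submodule.span ℂ (Set.range monomialMap)).topologicalClosure = ⊤ := by
  rw [← trigSubalgebra_coe]
  exact congr_arg (Subalgebra.toSubmodule <| StarSubalgebra.toSubalgebra ·)
    (ContinuousMap.starSubalgebra_topologicalClosure_eq_top_of_separatesPoints trigSubalgebra
      trigSubalgebra_separatesPoints)

theorem exists_polynomial_add_conj {g : C(Circle, ℂ)}
    (hg : g ∈ Submodule.span ℂ (Set.range monomialMap)) :
    ∃ P Q : ℂ[X], ∀ z : Circle, g z = P.eval (z : ℂ) + conj (Q.eval (z : ℂ)) := by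
  induction hg using Submodule.span_induction with
  | mem x hx =>
    obtain ⟨n, rfl⟩ := hx
    rcases n.eq_nat_or_neg with ⟨m, rfl | rfl⟩
    · exact ⟨X ^ m, 0, fun z => by simp [monomialMap_apply]⟩
    · refine ⟨0, X ^ m, fun z => ?_⟩
      rw [monomialMap_apply, ← conj_zpow_circle]
      simp
  | zero => exact ⟨0, 0, by simp⟩
  | add x y _ _ hx hy =>
    obtain ⟨P, Q, h⟩ := hx
    obtain ⟨P', Q', h'⟩ := hy
    refine ⟨P + P', Q + Q', fun z => ?_⟩
    simp only [ContinuousMap.add_apply, h, h', eval_add, map_add]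
    ring
  | smul a x _ hx =>
    obtain ⟨P, Q, h⟩ := hx
    refine ⟨C a * P, C (conj a) * Q, fun z => ?_⟩
    simp [h, mul_add]

/-- A real continuous function on the circle is uniformly close to the real part of a polynomial
that takes a real value at the origin. -/
theorem exists_polynomial_re_near (g : C(Circle, ℝ)) {ε : ℝ} (hε : 0 < ε) :
    ∃ P : ℂ[X], (P.eval 0).im = 0 ∧ ∀ z : Circle, |(P.eval (z : ℂ)).re - g z| < ε := by
  let G : C(Circle, ℂ) := ⟨fun z => (g z : ℂ), by fun_prop⟩
  have hG : G ∈ (Submodule.span ℂ (Set.range monomialMap)).topologicalClosure := by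
    rw [span_monomialMap_closure]; trivial
  obtain ⟨T, hT, hd⟩ := Metric.mem_closure_iff.1 hG ε hε
  obtain ⟨P, Q, h⟩ := exists_polynomial_add_conj hT
  -- On the circle `P + conj Q` and `P + Q` have the same real part. The subtracted constant is
  -- imaginary: it leaves the real part alone and makes the value at the origin real.
  refine ⟨P + Q - C (((P + Q).eval 0).im * Complex.I), by simp, fun z => ?_⟩
  have h1 : ‖T z - G z‖ < ε := by
    rw [← dist_eq_norm, dist_comm]
    exact (ContinuousMap.dist_apply_le_dist z).trans_lt hd
  refine lt_of_eq_of_lt ?_ ((Complex.abs_re_le_norm _).trans_lt h1)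
  simp [h, G]

/-- Rotation by `exp(iπ/n)` preserves the measure and changes the sign of the integrand, so the
integral is its own negative. -/
theorem integral_zpow_arc {n : ℤ} (hn : n ≠ 0) : ∫ z : Circle, (z : ℂ) ^ n ∂arc = 0 := by
  have hw : ((Circle.exp (Real.pi / n) : Circle) : ℂ) ^ n = -1 := by
    rw [Circle.coe_exp, ← Complex.exp_int_mul]
    have : (n : ℂ) ≠ 0 := by exact_mod_cast hn
    rw [← Complex.exp_pi_mul_I]
    congr 1
    push_cast
    field_simp
  have h := integral_mul_left_eq_self (μ := arc) (fun z : Circle => (z : ℂ) ^ n)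
    (Circle.exp (Real.pi / n))
  simp only [Circle.coe_mul, mul_zpow, hw, integral_const_mul] at h
  linear_combination (-1 / 2 : ℂ) * h

theorem integrable_of_continuous_arc {f : Circle → ℂ} (hf : Continuous f) : Integrable f arc :=
  hf.integrable_of_hasCompactSupport (HasCompactSupport.of_compactSpace f)

/-- Mean value property of polynomials. -/
theorem integral_eval_arc (P : ℂ[X]) : ∫ z : Circle, P.eval (z : ℂ) ∂arc = P.eval 0 := by
  induction P using Polynomial.induction_on' with
  | add P Q hP hQ =>
    simp only [eval_add]
    rw [integral_add, hP, hQ] <;> exact integrable_of_continuous_arc (by fun_prop)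
  | monomial n a =>
    simp only [eval_monomial, integral_const_mul]
    rcases eq_or_ne n 0 with rfl | hn
    · simp
    · have := integral_zpow_arc (n := n) (by exact_mod_cast hn)
      simp only [zpow_natCast] at this
      simp [this, hn]

/-- An integrable function is determined by its Fourier coefficients. -/
theorem ae_eq_zero_of_fourier {f : Circle → ℂ} (hf : Integrable f arc)
    (h : ∀ n : ℤ, ∫ z : Circle, f z * (z : ℂ) ^ n ∂arc = 0) : f =ᵐ[arc] 0 := by
  have hint : ∀ g : C(Circle, ℂ), Integrable (fun z => f z * g z) arc := fun g =>
    hf.mul_bdd (c := ‖g‖) g.continuous.aestronglyMeasurable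
      (Eventually.of_forall fun z => g.norm_coe_le_norm z)
  have hC : ∀ g : C(Circle, ℂ), ∫ z, f z * g z ∂arc = 0 := by
    have hspan : ∀ g ∈ Submodule.span ℂ (Set.range monomialMap), ∫ z, f z * g z ∂arc = 0 := by
      intro g hg
      induction hg using Submodule.span_induction with
      | mem x hx =>
        obtain ⟨n, rfl⟩ := hx
        simpa [monomialMap_apply] using h n
      | zero => simp
      | add x y _ _ hx hy =>
        simp only [ContinuousMap.add_apply, mul_add]
        rw [integral_add (hint x) (hint y), hx, hy, add_zero]
      | smul a x _ hx =>
        simp only [ContinuousMap.smul_apply, smul_eq_mul, mul_left_comm _ a]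
        rw [integral_const_mul, hx, mul_zero]
    intro g
    have hg : g ∈ (Submodule.span ℂ (Set.range monomialMap)).topologicalClosure := by
      rw [span_monomialMap_closure]; trivial
    obtain ⟨u, hu, hlim⟩ := mem_closure_iff_seq_limit.1 hg
    have hb : ∀ᶠ n in atTop, ‖u n‖ ≤ ‖g‖ + 1 :=
      (hlim.norm.eventually_lt_const (lt_add_one _)).mono fun _ => le_of_lt
    have ht : Tendsto (fun n => ∫ z, f z * u n z ∂arc) atTop (𝓝 (∫ z, f z * g z ∂arc)) := by
      refine tendsto_integral_filter_of_dominated_convergence (fun z => ‖f z‖ * (‖g‖ + 1))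
        (Eventually.of_forall fun n => (hint (u n)).aestronglyMeasurable) ?_
        (hf.norm.mul_const _) (Eventually.of_forall fun z => ?_)
      · filter_upwards [hb] with n hn
        refine Eventually.of_forall fun z => ?_
        rw [norm_mul]
        exact mul_le_mul_of_nonneg_left (((u n).norm_coe_le_norm z).trans hn) (norm_nonneg _)
      · exact ((continuous_eval_const z).tendsto g |>.comp hlim).const_mul (f z)
    refine tendsto_nhds_unique ht ?_
    simp only [hspan _ (hu _)]
    exact tendsto_const_nhds
  -- Integrals over closed sets determine `f`. The indicator of a closed set is a pointwise limit of
  -- continuous functions bounded by one, against which `f` integrates to zero.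
  refine ae_eq_zero_of_forall_setIntegral_isClosed_eq_zero hf fun s hs => ?_
  have ht : Tendsto (fun n : ℕ => ∫ z, f z *
        ((thickenedIndicator (Nat.one_div_pos_of_nat (α := ℝ) (n := n)) s z : ℝ) : ℂ) ∂arc) atTop
      (𝓝 (∫ z, f z * s.indicator (fun _ => (1 : ℂ)) z ∂arc)) := by
    refine tendsto_integral_of_dominated_convergence (fun z => ‖f z‖) (fun n => ?_) hf.norm
      (fun n => Eventually.of_forall fun z => ?_) (Eventually.of_forall fun z => ?_)
    · exact hf.aestronglyMeasurable.mul (by fun_prop : Continuous _).aestronglyMeasurable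
    · rw [norm_mul]
      refine mul_le_of_le_one_right (norm_nonneg _) ?_
      simpa using thickenedIndicator_le_one (Nat.one_div_pos_of_nat (α := ℝ) (n := n)) s z
    · refine Tendsto.const_mul _ ?_
      have := thickenedIndicator_tendsto_indicator_closure
        (fun n => Nat.one_div_pos_of_nat (α := ℝ) (n := n))
        (tendsto_one_div_add_atTop_nhds_zero_nat (𝕜 := ℝ)) s
      rw [tendsto_pi_nhds] at this
      have h2 := this z
      rw [hs.closure_eq] at h2
      have h3 : Continuous fun x : NNReal => ((x : ℝ) : ℂ) := by fun_prop
      have h4 : s.indicator (fun _ => (1 : ℂ)) z =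
          (((s.indicator (fun _ => (1 : NNReal)) z : NNReal) : ℝ) : ℂ) := by
        by_cases hz : z ∈ s
        · rw [Set.indicator_of_mem hz, Set.indicator_of_mem hz]; simp
        · rw [Set.indicator_of_notMem hz, Set.indicator_of_notMem hz]; simp
      rw [h4]
      exact (h3.tendsto _).comp h2
  have h0 : ∫ z, f z * s.indicator (fun _ => (1 : ℂ)) z ∂arc = 0 := by
    refine tendsto_nhds_unique ht ?_
    have : ∀ n : ℕ, ∫ z, f z *
        ((thickenedIndicator (Nat.one_div_pos_of_nat (α := ℝ) (n := n)) s z : ℝ) : ℂ) ∂arc = 0 :=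
      fun n => hC ⟨fun z => ((thickenedIndicator (Nat.one_div_pos_of_nat (α := ℝ) (n := n)) s z : ℝ)
        : ℂ), by fun_prop⟩
    simp only [this]
    exact tendsto_const_nhds
  rw [← integral_indicator hs.measurableSet, ← h0]
  congr 1
  ext z
  by_cases hz : z ∈ s <;> simp [hz]

theorem memLp_of_continuous_arc {E : Type*} [NormedAddCommGroup E] {f : Circle → E}
    (hf : Continuous f) (p : ℝ≥0∞) : MemLp f p arc :=
  hf.memLp_of_hasCompactSupport (HasCompactSupport.of_compactSpace f)

theorem continuous_eval_circle (P : ℂ[X]) : Continuous fun z : Circle => P.eval (z : ℂ) := by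
  fun_prop

-- Analytic completion in `L²`

/-- A polynomial that is real at the origin is controlled in `L²` by its real part. -/
theorem eLpNorm_eval_le (P : ℂ[X]) (hP : (P.eval 0).im = 0) :
    eLpNorm (fun z : Circle => P.eval (z : ℂ)) 2 arc ≤
      2 * eLpNorm (fun z : Circle => (P.eval (z : ℂ)).re) 2 arc := by
  have hc := continuous_eval_circle P
  have hre : Continuous fun z : Circle => (P.eval (z : ℂ)).re := Complex.continuous_re.comp hc
  have him : Continuous fun z : Circle => (P.eval (z : ℂ)).im := Complex.continuous_im.comp hc
  have hint : ∀ f : Circle → ℝ, Continuous f → Integrable f arc := fun f hf =>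
    hf.integrable_of_hasCompactSupport (HasCompactSupport.of_compactSpace f)
  have h1 : ∫ z : Circle, (P.eval (z : ℂ)).im ^ 2 ∂arc ≤
      ∫ z : Circle, (P.eval (z : ℂ)).re ^ 2 ∂arc := by
    -- The mean value property of `P²` reads `∫ (Re P)² - ∫ (Im P)² = (Re P(0))² ≥ 0`, because
    -- `P(0)` is real.
    have h2 := congr_arg Complex.re (integral_eval_arc (P ^ 2))
    have h3 := integral_re (𝕜 := ℂ) (integrable_of_continuous_arc (continuous_eval_circle (P ^ 2)))
    simp only [RCLike.re_to_complex] at h3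
    rw [← h3] at h2
    simp only [sq, eval_mul, Complex.mul_re, hP, mul_zero, sub_zero] at h2
    have hi : Integrable (fun z : Circle => (P.eval (z : ℂ)).re * (P.eval (z : ℂ)).re) arc :=
      hint _ (hre.mul hre)
    have hi' : Integrable (fun z : Circle => (P.eval (z : ℂ)).im * (P.eval (z : ℂ)).im) arc :=
      hint _ (him.mul him)
    replace h2 := (integral_sub hi hi').symm.trans h2
    simp only [sq]
    nlinarith [mul_self_nonneg (P.eval 0).re]
  have h4 : eLpNorm (fun z : Circle => (P.eval (z : ℂ)).im) 2 arc ≤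
      eLpNorm (fun z : Circle => (P.eval (z : ℂ)).re) 2 arc := by
    rw [(memLp_of_continuous_arc him 2).eLpNorm_eq_integral_rpow_norm (by simp) (by simp),
      (memLp_of_continuous_arc hre 2).eLpNorm_eq_integral_rpow_norm (by simp) (by simp)]
    refine ENNReal.ofReal_le_ofReal (Real.rpow_le_rpow (by positivity) ?_ (by simp))
    simpa using h1
  calc eLpNorm (fun z : Circle => P.eval (z : ℂ)) 2 arc
      = eLpNorm ((fun z : Circle => ((P.eval (z : ℂ)).re : ℂ)) +
          fun z : Circle => Complex.I * ((P.eval (z : ℂ)).im : ℂ)) 2 arc := by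
        congr 1
        ext z
        simp only [Pi.add_apply]
        rw [mul_comm Complex.I, Complex.re_add_im]
    _ ≤ eLpNorm (fun z : Circle => ((P.eval (z : ℂ)).re : ℂ)) 2 arc +
          eLpNorm (fun z : Circle => Complex.I * ((P.eval (z : ℂ)).im : ℂ)) 2 arc :=
        eLpNorm_add_le (by fun_prop : Continuous _).aestronglyMeasurable
          (by fun_prop : Continuous _).aestronglyMeasurable (by norm_num)
    _ = eLpNorm (fun z : Circle => (P.eval (z : ℂ)).re) 2 arc +
          eLpNorm (fun z : Circle => (P.eval (z : ℂ)).im) 2 arc := by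
        congr 1 <;> refine eLpNorm_congr_norm_ae (Eventually.of_forall fun z => ?_) <;> simp
    _ ≤ _ := by
        rw [two_mul]
        gcongr

/-- A nonnegative function in `L²` is approximated by nonnegative real parts of polynomials. -/
theorem exists_polynomial_re_nonneg {u : Circle → ℝ} (hu : MemLp u 2 arc) (hu0 : ∀ z, 0 ≤ u z)
    {ε : ℝ} (hε : 0 < ε) :
    ∃ P : ℂ[X], (P.eval 0).im = 0 ∧ (∀ z : Circle, 0 ≤ (P.eval (z : ℂ)).re) ∧
      eLpNorm (fun z : Circle => (P.eval (z : ℂ)).re - u z) 2 arc ≤ ENNReal.ofReal ε := by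
  obtain ⟨b, hb, -⟩ := hu.exists_boundedContinuous_eLpNorm_sub_le (by simp)
    (ε := ENNReal.ofReal (ε / 2)) (by simpa using hε)
  -- The shift by `ε/4` absorbs the error of the uniform approximation, so that the real part stays
  -- nonnegative. Taking the positive part of `b` does not increase its distance to `u ≥ 0`.
  let g : C(Circle, ℝ) := ⟨fun z => max (b z) 0 + ε / 4, by fun_prop⟩
  obtain ⟨P, hP, hg⟩ := exists_polynomial_re_near g (ε := ε / 4) (by linarith)
  refine ⟨P, hP, fun z => ?_, ?_⟩
  · have := (abs_lt.1 (hg z)).1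
    have h2 : g z = max (b z) 0 + ε / 4 := rfl
    have := le_max_right (b z) 0
    linarith
  · have hre : Continuous fun z : Circle => (P.eval (z : ℂ)).re := by fun_prop
    have hb' : Continuous fun z : Circle => max (b z) 0 := by fun_prop
    calc eLpNorm (fun z : Circle => (P.eval (z : ℂ)).re - u z) 2 arc
        = eLpNorm ((fun z : Circle => (P.eval (z : ℂ)).re - max (b z) 0) +
            fun z : Circle => max (b z) 0 - u z) 2 arc := by
          congr 1; ext z; simp
      _ ≤ eLpNorm (fun z : Circle => (P.eval (z : ℂ)).re - max (b z) 0) 2 arc +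
            eLpNorm (fun z : Circle => max (b z) 0 - u z) 2 arc :=
          eLpNorm_add_le (hre.sub hb').aestronglyMeasurable
            (hb'.aestronglyMeasurable.sub hu.aestronglyMeasurable) (by norm_num)
      _ ≤ ENNReal.ofReal (ε / 2) + ENNReal.ofReal (ε / 2) := by
          refine add_le_add ?_ (le_trans (eLpNorm_mono fun z => ?_) hb)
          · refine (eLpNorm_le_of_ae_bound (C := ε / 2) (Eventually.of_forall fun z => ?_)).trans ?_
            · have h2 : g z = max (b z) 0 + ε / 4 := rfl
              have := abs_lt.1 (hg z)
              rw [Real.norm_eq_abs, abs_le]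
              constructor <;> linarith
            · simp
          · rw [Pi.sub_apply, Real.norm_eq_abs, Real.norm_eq_abs, abs_sub_comm (u z)]
            have := abs_max_sub_max_le_abs (b z) (u z) 0
            rwa [max_eq_left (hu0 z)] at this
      _ = ENNReal.ofReal ε := by
          rw [← ENNReal.ofReal_add (by linarith) (by linarith), add_halves]

/-- Analytic completion: a nonnegative function in `L²` is the real part of an almost everywhere
limit of polynomials with nonnegative real parts. -/
theorem exists_analytic_completion {u : Circle → ℝ} (hu : MemLp u 2 arc) (hu0 : ∀ z, 0 ≤ u z) :
    ∃ q : Circle → ℂ, MemLp q 2 arc ∧ (∀ᵐ z ∂arc, (q z).re = u z) ∧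
      eLpNorm q 2 arc ≤ 2 * eLpNorm u 2 arc ∧
      ∃ Q : ℕ → ℂ[X], (∀ n (z : Circle), 0 ≤ ((Q n).eval (z : ℂ)).re) ∧
        ∀ᵐ z : Circle ∂arc, Tendsto (fun n => (Q n).eval (z : ℂ)) atTop (𝓝 (q z)) := by
  choose Q hQ0 hQpos hQ using fun n : ℕ =>
    exists_polynomial_re_nonneg hu hu0 (ε := (1 / 2 : ℝ) ^ n) (by positivity)
  have hmem : ∀ n, MemLp (fun z : Circle => (Q n).eval (z : ℂ)) 2 arc := fun n =>
    memLp_of_continuous_arc (continuous_eval_circle _) 2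
  have hmre : ∀ n, MemLp (fun z : Circle => ((Q n).eval (z : ℂ)).re) 2 arc := fun n =>
    memLp_of_continuous_arc (by fun_prop) 2
  let q : ℕ → Lp ℂ 2 arc := fun n => (hmem n).toLp _
  -- The constant is `2 * (1 + 1)`: the factor of `eLpNorm_eval_le` times the errors of `Q n` and `Q
  -- (n + 1)`.
  have hdist : ∀ n, dist (q n) (q (n + 1)) ≤ 4 * (1 / 2 : ℝ) ^ n := by
    intro n
    have e : edist (q n) (q (n + 1)) ≤ ENNReal.ofReal (4 * (1 / 2 : ℝ) ^ n) := by
      rw [Lp.edist_toLp_toLp]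
      have h1 := eLpNorm_eval_le (Q n - Q (n + 1)) (by simp [hQ0])
      simp only [eval_sub, Complex.sub_re] at h1
      refine le_trans (le_of_eq rfl) (h1.trans ?_)
      have h2 : eLpNorm (fun z : Circle => ((Q n).eval (z : ℂ)).re - ((Q (n + 1)).eval (z : ℂ)).re)
          2 arc ≤ ENNReal.ofReal ((1 / 2 : ℝ) ^ n) + ENNReal.ofReal ((1 / 2 : ℝ) ^ n) := by
        calc _ = eLpNorm ((fun z : Circle => ((Q n).eval (z : ℂ)).re - u z) -
              fun z : Circle => ((Q (n + 1)).eval (z : ℂ)).re - u z) 2 arc := by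
                congr 1; ext z; simp
          _ ≤ _ := eLpNorm_sub_le ((hmre n).sub hu).aestronglyMeasurable
              ((hmre (n + 1)).sub hu).aestronglyMeasurable (by norm_num)
          _ ≤ _ := add_le_add (hQ n) ((hQ (n + 1)).trans (ENNReal.ofReal_le_ofReal
              (pow_le_pow_of_le_one (by norm_num) (by norm_num) (Nat.le_succ n))))
      calc _ ≤ 2 * (ENNReal.ofReal ((1 / 2 : ℝ) ^ n) + ENNReal.ofReal ((1 / 2 : ℝ) ^ n)) := by
            gcongr
        _ = ENNReal.ofReal (4 * (1 / 2 : ℝ) ^ n) := by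
            rw [← ENNReal.ofReal_add (by positivity) (by positivity),
              show (2 : ℝ≥0∞) = ENNReal.ofReal 2 by simp, ← ENNReal.ofReal_mul (by norm_num)]
            congr 1; ring
    rw [edist_dist] at e
    exact (ENNReal.ofReal_le_ofReal_iff (by positivity)).1 e
  obtain ⟨q', hq'⟩ := cauchySeq_tendsto_of_complete
    (cauchySeq_of_le_geometric (1 / 2 : ℝ) 4 (by norm_num) hdist)
  obtain ⟨s, hs, hae⟩ := (tendstoInMeasure_of_tendsto_Lp hq').exists_seq_tendsto_ae
  have hret : Tendsto (fun n => eLpNorm ((fun z : Circle => ((Q n).eval (z : ℂ)).re) - u) 2 arc)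
      atTop (𝓝 0) := by
    have : Tendsto (fun n : ℕ => ENNReal.ofReal ((1 / 2 : ℝ) ^ n)) atTop (𝓝 0) := by
      rw [← ENNReal.ofReal_zero]
      exact ENNReal.tendsto_ofReal (tendsto_pow_atTop_nhds_zero_of_lt_one (by norm_num)
        (by norm_num))
    exact tendsto_of_tendsto_of_tendsto_of_le_of_le tendsto_const_nhds this
      (fun _ => zero_le) hQ
  -- A further subsequence, along which the real parts tend to `u` almost everywhere, identifies `Re
  -- q'` with `u`.
  obtain ⟨t, ht, hae'⟩ := (tendstoInMeasure_of_tendsto_eLpNorm (p := 2) (by simp)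
    (fun n => (hmre (s n)).aestronglyMeasurable) hu.aestronglyMeasurable
    (hret.comp hs.tendsto_atTop)).exists_seq_tendsto_ae
  have hcoe : ∀ᵐ z : Circle ∂arc, ∀ n, q n z = (Q n).eval (z : ℂ) :=
    ae_all_iff.2 fun n => (hmem n).coeFn_toLp
  refine ⟨q', Lp.memLp q', ?_, ?_, fun n => Q (s n), fun n z => hQpos _ z, ?_⟩
  · filter_upwards [hae, hae', hcoe] with z h1 h2 h3
    simp only [h3] at h1
    exact tendsto_nhds_unique ((Complex.continuous_re.tendsto _).comp
      (h1.comp ht.tendsto_atTop)) h2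
  · have h1 : Tendsto (fun n => ‖q n‖ₑ) atTop (𝓝 ‖q'‖ₑ) := (continuous_enorm.tendsto _).comp hq'
    have h2 : ∀ n, ‖q n‖ₑ ≤ 2 * (eLpNorm u 2 arc + ENNReal.ofReal ((1 / 2 : ℝ) ^ n)) := by
      intro n
      rw [Lp.enorm_toLp]
      refine (eLpNorm_eval_le (Q n) (hQ0 n)).trans ?_
      gcongr
      calc _ = eLpNorm (u + fun z : Circle => ((Q n).eval (z : ℂ)).re - u z) 2 arc := by
            congr 1; ext z; simp
        _ ≤ _ := (eLpNorm_add_le hu.aestronglyMeasurable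
            ((hmre n).sub hu).aestronglyMeasurable (by norm_num)).trans
              (add_le_add le_rfl (hQ n))
    have h3 : Tendsto (fun n : ℕ => 2 * (eLpNorm u 2 arc + ENNReal.ofReal ((1 / 2 : ℝ) ^ n)))
        atTop (𝓝 (2 * (eLpNorm u 2 arc + 0))) := by
      refine ENNReal.Tendsto.const_mul (tendsto_const_nhds.add ?_) (Or.inr (by simp))
      rw [← ENNReal.ofReal_zero]
      exact ENNReal.tendsto_ofReal (tendsto_pow_atTop_nhds_zero_of_lt_one (by norm_num)
        (by norm_num))
    rw [add_zero] at h3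
    have := le_of_tendsto_of_tendsto' h1 h3 h2
    rwa [Lp.enorm_def] at this
  · filter_upwards [hae, hcoe] with z h1 h3
    simpa only [h3] using h1

-- Dominated convergence and bounded analytic multipliers

/-- Dominated convergence in `L^p`. -/
theorem tendsto_eLpNorm_sub_of_dominated {α E : Type*} [MeasurableSpace α] {μ : Measure α}
    [NormedAddCommGroup E] {p : ℝ≥0∞} (hp0 : p ≠ 0) (hp : p ≠ ∞) {f : ℕ → α → E} {g : α → E}
    {G : α → ℝ} (hG : MemLp G p μ) (hf : ∀ n, AEStronglyMeasurable (f n) μ)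
    (hb : ∀ n, ∀ᵐ x ∂μ, ‖f n x‖ ≤ G x)
    (hlim : ∀ᵐ x ∂μ, Tendsto (fun n => f n x) atTop (𝓝 (g x))) :
    Tendsto (fun n => eLpNorm (f n - g) p μ) atTop (𝓝 0) := by
  have hpos : 0 < p.toReal := ENNReal.toReal_pos hp0 hp
  have hg : AEStronglyMeasurable g μ := aestronglyMeasurable_of_tendsto_ae _ hf hlim
  have hgb : ∀ᵐ x ∂μ, ‖g x‖ ≤ G x := by
    filter_upwards [hlim, ae_all_iff.2 hb] with x h1 h2
    exact le_of_tendsto' h1.norm h2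
  have key : Tendsto (fun n => ∫⁻ x, ‖(f n - g) x‖ₑ ^ p.toReal ∂μ) atTop (𝓝 (∫⁻ _, 0 ∂μ)) := by
    refine tendsto_lintegral_of_dominated_convergence' (fun x => ‖(2 * G x : ℝ)‖ₑ ^ p.toReal)
      (fun n => ((hf n).sub hg).enorm.pow_const _) (fun n => ?_) ?_ ?_
    · filter_upwards [hb n, hgb] with x h1 h2
      refine ENNReal.rpow_le_rpow ?_ hpos.le
      rw [enorm_le_iff_norm_le]
      calc ‖(f n - g) x‖ ≤ ‖f n x‖ + ‖g x‖ := norm_sub_le _ _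
        _ ≤ 2 * G x := by linarith
        _ ≤ _ := le_abs_self _
    · exact (lintegral_rpow_enorm_lt_top_of_eLpNorm_lt_top hp0 hp (hG.const_mul 2).2).ne
    · filter_upwards [hlim] with x hx
      have h1 : Tendsto (fun n => ‖f n x - g x‖ₑ) atTop (𝓝 0) := by
        simpa using (tendsto_sub_nhds_zero_iff.2 hx).enorm
      have h2 := ((ENNReal.continuous_rpow_const (y := p.toReal)).tendsto 0).comp h1
      rwa [ENNReal.zero_rpow_of_pos hpos] at h2
  rw [lintegral_zero] at key
  have h2 := ((ENNReal.continuous_rpow_const (y := 1 / p.toReal)).tendsto 0).comp key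
  rw [ENNReal.zero_rpow_of_pos (by positivity)] at h2
  refine h2.congr fun n => ?_
  rw [eLpNorm_eq_lintegral_rpow_enorm_toReal hp0 hp]
  rfl

section Multipliers

variable {p : ℝ≥0∞}

/-- The function `f` represents an element of the subspace `M`. -/
def HasRep (M : Submodule ℂ (Lp ℂ p arc)) (f : Circle → ℂ) : Prop :=
  ∃ h ∈ M, (h : Circle → ℂ) =ᵐ[arc] f

namespace HasRep

variable {M : Submodule ℂ (Lp ℂ p arc)} {f g : Circle → ℂ}

theorem memLp (h : HasRep M f) : MemLp f p arc := by
  obtain ⟨h, -, hf⟩ := h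
  exact (memLp_congr_ae hf).1 (Lp.memLp h)

theorem congr (h : HasRep M f) (hfg : f =ᵐ[arc] g) : HasRep M g := by
  obtain ⟨h, hM, hf⟩ := h
  exact ⟨h, hM, hf.trans hfg⟩

theorem toLp_mem (h : HasRep M f) (hf : MemLp f p arc) : hf.toLp f ∈ M := by
  obtain ⟨h, hM, hh⟩ := h
  rwa [show hf.toLp f = h from Lp.ext (hf.coeFn_toLp.trans hh.symm)]

theorem of_mem {h : Lp ℂ p arc} (hM : h ∈ M) : HasRep M h := ⟨h, hM, ae_eq_rfl⟩

theorem mem {h : Lp ℂ p arc} (hM : HasRep M h) : h ∈ M := by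
  obtain ⟨h', hM', hh⟩ := hM
  rwa [← Lp.ext hh]

theorem zero : HasRep M 0 := ⟨0, M.zero_mem, Lp.coeFn_zero _ _ _⟩

theorem add (hf : HasRep M f) (hg : HasRep M g) : HasRep M (f + g) := by
  obtain ⟨h, hM, hh⟩ := hf
  obtain ⟨k, kM, hk⟩ := hg
  exact ⟨h + k, M.add_mem hM kM, (Lp.coeFn_add h k).trans (hh.add hk)⟩

theorem const_mul (c : ℂ) (hf : HasRep M f) : HasRep M (fun z => c * f z) := by
  obtain ⟨h, hM, hh⟩ := hf
  refine ⟨c • h, M.smul_mem c hM, (Lp.coeFn_smul c h).trans ?_⟩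
  filter_upwards [hh] with z hz
  simp [hz]

theorem zmul (hz : ZInvariant (M : Set (Lp ℂ p arc))) (hf : HasRep M f) :
    HasRep M (fun z => (z : ℂ) * f z) := by
  obtain ⟨h, hM, hh⟩ := hf
  obtain ⟨k, kM, hk⟩ := hz h hM
  refine ⟨k, kM, ?_⟩
  filter_upwards [hh, hk] with z h1 h2
  rw [h2, h1]

theorem pow_mul (hz : ZInvariant (M : Set (Lp ℂ p arc))) (hf : HasRep M f) (n : ℕ) :
    HasRep M (fun z => (z : ℂ) ^ n * f z) := by
  induction n with
  | zero => simpa using hf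
  | succ n ih => simpa only [pow_succ', mul_assoc] using ih.zmul hz

theorem eval_mul (hz : ZInvariant (M : Set (Lp ℂ p arc))) (hf : HasRep M f) (P : ℂ[X]) :
    HasRep M (fun z => P.eval (z : ℂ) * f z) := by
  induction P using Polynomial.induction_on' with
  | add P Q hP hQ =>
    refine (hP.add hQ).congr (Eventually.of_forall fun z => ?_)
    simp [add_mul]
  | monomial n a =>
    simpa only [eval_monomial, mul_assoc] using (hf.pow_mul hz n).const_mul a

/-- Closed subspaces are stable under dominated convergence. -/
theorem of_dominated [Fact (1 ≤ p)] (hp : p ≠ ∞) (hM : IsClosed (M : Set (Lp ℂ p arc)))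
    {f : ℕ → Circle → ℂ} {G : Circle → ℝ} (hf : ∀ n, HasRep M (f n)) (hG : MemLp G p arc)
    (hb : ∀ n, ∀ᵐ z ∂arc, ‖f n z‖ ≤ G z)
    (hlim : ∀ᵐ z ∂arc, Tendsto (fun n => f n z) atTop (𝓝 (g z))) : HasRep M g := by
  have hp0 : p ≠ 0 := (zero_lt_one.trans_le (Fact.out : 1 ≤ p)).ne'
  have hgm : AEStronglyMeasurable g arc :=
    aestronglyMeasurable_of_tendsto_ae _ (fun n => (hf n).memLp.aestronglyMeasurable) hlim
  have hg : MemLp g p arc := by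
    refine hG.mono hgm ?_
    filter_upwards [hlim, ae_all_iff.2 hb] with x h1 h2
    exact (le_of_tendsto' h1.norm h2).trans (le_abs_self _)
  have ht := (Lp.tendsto_Lp_iff_tendsto_eLpNorm'' f (fun n => (hf n).memLp) g hg).2
    (tendsto_eLpNorm_sub_of_dominated hp0 hp hG
      (fun n => (hf n).memLp.aestronglyMeasurable) hb hlim)
  exact ⟨hg.toLp g, hM.mem_of_tendsto ht (Eventually.of_forall fun n => (hf n).toLp_mem _),
    hg.coeFn_toLp⟩

end HasRep

/-- Multiplication by `k` maps the subspace `M` into itself. -/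
def IsMultiplier (M : Submodule ℂ (Lp ℂ p arc)) (k : Circle → ℂ) : Prop :=
  ∀ f, HasRep M f → HasRep M (fun z => k z * f z)

variable {M : Submodule ℂ (Lp ℂ p arc)}

/-- Dominated convergence with majorant `C|f|`: pointwise bounded convergence of the multipliers is
enough. -/
theorem IsMultiplier.of_bounded_tendsto [Fact (1 ≤ p)] (hp : p ≠ ∞)
    (hM : IsClosed (M : Set (Lp ℂ p arc))) {k : ℕ → Circle → ℂ} {k' : Circle → ℂ} {C : ℝ}
    (hk : ∀ n, IsMultiplier M (k n)) (hb : ∀ n, ∀ᵐ z ∂arc, ‖k n z‖ ≤ C)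
    (hlim : ∀ᵐ z ∂arc, Tendsto (fun n => k n z) atTop (𝓝 (k' z))) : IsMultiplier M k' := by
  intro f hf
  refine HasRep.of_dominated hp hM (fun n => hk n f hf) (hf.memLp.norm.const_mul C) (fun n => ?_) ?_
  · filter_upwards [hb n] with z hz
    rw [norm_mul]
    gcongr
  · filter_upwards [hlim] with z hz using hz.mul_const _

/-- The polynomials `(1 - Q/n)^n` tend to `exp(-Q)`, and where `|Q| ≤ R` they are bounded by `exp
R`. -/
theorem isMultiplier_exp_neg [Fact (1 ≤ p)] (hp : p ≠ ∞)
    (hM : IsClosed (M : Set (Lp ℂ p arc))) (hz : ZInvariant (M : Set (Lp ℂ p arc))) (Q : ℂ[X]) :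
    IsMultiplier M (fun z => Complex.exp (-Q.eval (z : ℂ))) := by
  obtain ⟨R, hR⟩ := isCompact_univ.exists_bound_of_continuousOn
    (continuous_eval_circle Q).continuousOn
  refine IsMultiplier.of_bounded_tendsto hp hM (C := Real.exp R)
    (k := fun n z => (1 + -Q.eval (z : ℂ) / n) ^ n) (fun n f hf => ?_)
    (fun n => Eventually.of_forall fun z => ?_) (Eventually.of_forall fun z =>
      Complex.tendsto_one_add_div_pow_exp _)
  · have := hf.eval_mul hz ((1 + C (-(n : ℂ)⁻¹) * Q) ^ n)
    refine this.congr (Eventually.of_forall fun z => ?_)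
    simp only [eval_pow, eval_add, eval_one, Polynomial.eval_mul, eval_C]
    ring
  · rw [norm_pow]
    have hR0 : ‖Q.eval (z : ℂ)‖ ≤ R := hR z trivial
    rcases Nat.eq_zero_or_pos n with rfl | hn
    · simpa using (norm_nonneg _).trans hR0
    calc ‖1 + -Q.eval (z : ℂ) / n‖ ^ n ≤ (1 + R / n) ^ n := by
          gcongr
          refine (norm_add_le _ _).trans ?_
          rw [norm_one, norm_div, norm_neg, Complex.norm_natCast]
          gcongr
      _ ≤ Real.exp (R / n) ^ n := by
          have := (norm_nonneg _).trans hR0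
          gcongr
          rw [add_comm]
          exact Real.add_one_le_exp _
      _ = Real.exp R := by
          rw [← Real.exp_nat_mul]
          congr 1
          field_simp

/-- With `x = max 1 F`, the bound `log x = 2 log √x ≤ 2√x` gives `(log x)² ≤ 4x ≤ 4 + 4F`. -/
theorem memLp_log_max {F : Circle → ℝ} (hF : Integrable F arc) (hF0 : ∀ z, 0 ≤ F z) :
    MemLp (fun z => Real.log (max 1 (F z))) 2 arc := by
  have hm : AEStronglyMeasurable (fun z => Real.log (max 1 (F z))) arc :=
    (Real.measurable_log.comp_aemeasurable
      (aemeasurable_const.max hF.aestronglyMeasurable.aemeasurable)).aestronglyMeasurable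
  rw [memLp_two_iff_integrable_sq hm]
  refine ((integrable_const (4 : ℝ)).add (hF.const_mul 4)).mono' (hm.pow 2)
    (Eventually.of_forall fun z => ?_)
  set x := max 1 (F z) with hx
  have h1 : 1 ≤ x := le_max_left _ _
  have h2 : x ≤ 1 + F z := max_le (by linarith [hF0 z]) (by linarith)
  have h3 : Real.log x = 2 * Real.log (√x) := by
    rw [Real.log_sqrt (by linarith)]; ring
  have h4 : Real.log (√x) ≤ √x := (Real.log_le_sub_one_of_pos (by positivity)).trans (by linarith)
  have h5 : 0 ≤ Real.log x := Real.log_nonneg h1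
  rw [Real.norm_of_nonneg (by positivity)]
  simp only [Pi.add_apply]
  have h6 : √x ^ 2 = x := Real.sq_sqrt (by linarith)
  have h7 : Real.log x ^ 2 ≤ (2 * √x) ^ 2 := by
    gcongr
    linarith
  nlinarith

/-- Truncation by bounded analytic functions: an integrable function becomes bounded after
multiplication by suitable multipliers which tend to one. -/
theorem exists_truncating_multipliers [Fact (1 ≤ p)] (hp : p ≠ ∞)
    (hM : IsClosed (M : Set (Lp ℂ p arc))) (hz : ZInvariant (M : Set (Lp ℂ p arc)))
    {F : Circle → ℝ} (hF : Integrable F arc) (hF0 : ∀ z, 0 ≤ F z) :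
    ∃ (k : ℕ → Circle → ℂ) (C : ℕ → ℝ), (∀ n, IsMultiplier M (k n)) ∧
      (∀ n, ∀ᵐ z ∂arc, ‖k n z‖ ≤ 1) ∧ (∀ n, ∀ᵐ z ∂arc, ‖k n z‖ * F z ≤ C n) ∧
      ∀ᵐ z ∂arc, Tendsto (fun n => k n z) atTop (𝓝 1) := by
  -- The choice gives `exp(-u n) * F ≤ n + 1`, and `u n` vanishes at each point once `n ≥ F`.
  let u : ℕ → Circle → ℝ := fun n z => Real.log (max 1 (F z / (n + 1)))
  have hu0 : ∀ n z, 0 ≤ u n z := fun n z => Real.log_nonneg (le_max_left _ _)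
  have hu : ∀ n, MemLp (u n) 2 arc := fun n =>
    memLp_log_max (hF.div_const _) fun z => div_nonneg (hF0 z) (by positivity)
  have hlim : Tendsto (fun n => eLpNorm (u n - 0) 2 arc) atTop (𝓝 0) := by
    refine tendsto_eLpNorm_sub_of_dominated (by simp) (by simp) (hu 0)
      (fun n => (hu n).aestronglyMeasurable) (fun n => Eventually.of_forall fun z => ?_)
      (Eventually.of_forall fun z => ?_)
    · rw [Real.norm_of_nonneg (hu0 n z)]
      refine Real.log_le_log (by positivity) (max_le_max le_rfl ?_)
      refine div_le_div_of_nonneg_left (hF0 z) (by simp) ?_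
      simp
    · refine tendsto_const_nhds.congr' ?_
      filter_upwards [eventually_ge_atTop ⌈F z⌉₊] with n hn
      have : F z ≤ n := (Nat.le_ceil _).trans (by exact_mod_cast hn)
      have h2 : F z / (n + 1) ≤ 1 := by
        rw [div_le_one (by positivity)]
        linarith
      simp [u, max_eq_left h2]
  choose q hq hre hnorm Q hQ0 hQ using fun n => exists_analytic_completion (hu n) (hu0 n)
  have hqlim : Tendsto (fun n => eLpNorm (q n - 0) 2 arc) atTop (𝓝 0) := by
    have h2 : Tendsto (fun n => 2 * eLpNorm (u n) 2 arc) atTop (𝓝 (2 * 0)) :=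
      ENNReal.Tendsto.const_mul (by simpa using hlim) (Or.inr (by simp))
    rw [mul_zero] at h2
    refine tendsto_of_tendsto_of_tendsto_of_le_of_le tendsto_const_nhds h2 (fun _ => zero_le)
      fun n => ?_
    simpa using hnorm n
  obtain ⟨s, -, hs⟩ := (tendstoInMeasure_of_tendsto_eLpNorm (p := 2) (by simp)
    (fun n => (hq n).aestronglyMeasurable) aestronglyMeasurable_zero hqlim).exists_seq_tendsto_ae
  have hnormk : ∀ n, ∀ᵐ z ∂arc, ‖Complex.exp (-q n z)‖ = Real.exp (-u n z) := by
    intro n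
    filter_upwards [hre n] with z hz
    rw [Complex.norm_exp, Complex.neg_re, hz]
  refine ⟨fun n z => Complex.exp (-q (s n) z), fun n => s n + 1, fun n => ?_, fun n => ?_,
    fun n => ?_, ?_⟩
  -- The polynomials `Q (s n) j` have nonnegative real part, so the approximating multipliers
  -- `exp(-Q)` are bounded by one.
  · refine IsMultiplier.of_bounded_tendsto hp hM (C := 1)
      (fun j => isMultiplier_exp_neg hp hM hz (Q (s n) j))
      (fun j => Eventually.of_forall fun z => ?_) ?_
    · rw [Complex.norm_exp, Complex.neg_re, Real.exp_le_one_iff]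
      linarith [hQ0 (s n) j z]
    · filter_upwards [hQ (s n)] with z hz
      exact (Complex.continuous_exp.tendsto _).comp hz.neg
  · filter_upwards [hnormk (s n)] with z hz
    rw [hz, Real.exp_le_one_iff]
    linarith [hu0 (s n) z]
  · filter_upwards [hnormk (s n)] with z hz
    have hpos : (0 : ℝ) < s n + 1 := by positivity
    rw [hz, Real.exp_neg, Real.exp_log (by positivity), inv_mul_le_iff₀ (by positivity),
      ← div_le_iff₀ hpos]
    exact le_max_right _ _
  · filter_upwards [hs] with z hz
    have := (Complex.continuous_exp.tendsto _).comp hz.neg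
    simpa [Function.comp_def] using this

end Multipliers

-- Multiplication operators that are isometries

/-- Multiplication by a function `w` which preserves the `L^p` norm, as a linear isometry. -/
def mulIsometry {α : Type*} [MeasurableSpace α] {μ ν : Measure α} {p : ℝ≥0∞} [Fact (1 ≤ p)]
    (w : α → ℂ) (hac : ν ≪ μ) (hw : ∀ f : α → ℂ, MemLp f p μ →
      MemLp (fun x => w x * f x) p ν ∧ eLpNorm (fun x => w x * f x) p ν = eLpNorm f p μ) :
    Lp ℂ p μ →ₗᵢ[ℂ] Lp ℂ p ν where
  toFun f := (hw f (Lp.memLp f)).1.toLp _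
  map_add' f g := by
    refine Lp.ext ?_
    filter_upwards [(hw _ (Lp.memLp (f + g))).1.coeFn_toLp, (hw _ (Lp.memLp f)).1.coeFn_toLp,
      (hw _ (Lp.memLp g)).1.coeFn_toLp, hac.ae_le (Lp.coeFn_add f g),
      Lp.coeFn_add ((hw f (Lp.memLp f)).1.toLp _) ((hw g (Lp.memLp g)).1.toLp _)]
      with x h1 h2 h3 h4 h5
    rw [h1, h5, Pi.add_apply, h2, h3, h4, Pi.add_apply, mul_add]
  map_smul' c f := by
    refine Lp.ext ?_
    filter_upwards [(hw _ (Lp.memLp (c • f))).1.coeFn_toLp, (hw _ (Lp.memLp f)).1.coeFn_toLp,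
      hac.ae_le (Lp.coeFn_smul c f), Lp.coeFn_smul c ((hw f (Lp.memLp f)).1.toLp _)]
      with x h1 h2 h3 h4
    simp only [RingHom.id_apply]
    rw [h1, h4, Pi.smul_apply, h2, h3, Pi.smul_apply, smul_eq_mul, smul_eq_mul, mul_left_comm]
  norm_map' f := by
    change ‖(hw f (Lp.memLp f)).1.toLp _‖ = ‖f‖
    rw [Lp.norm_toLp, (hw f (Lp.memLp f)).2, Lp.norm_def]

theorem coeFn_mulIsometry {α : Type*} [MeasurableSpace α] {μ ν : Measure α} {p : ℝ≥0∞}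
    [Fact (1 ≤ p)] {w : α → ℂ} (hac : ν ≪ μ) (hw : ∀ f : α → ℂ, MemLp f p μ →
      MemLp (fun x => w x * f x) p ν ∧ eLpNorm (fun x => w x * f x) p ν = eLpNorm f p μ)
    (f : Lp ℂ p μ) : mulIsometry w hac hw f =ᵐ[ν] fun x => w x * f x :=
  (hw f (Lp.memLp f)).1.coeFn_toLp

theorem memLp_unimodular_mul {w : Circle → ℂ} (hm : Measurable w) (hw : ∀ z, ‖w z‖ = 1)
    {p : ℝ≥0∞} (f : Circle → ℂ) (hf : MemLp f p arc) :
    MemLp (fun z => w z * f z) p arc ∧ eLpNorm (fun z => w z * f z) p arc = eLpNorm f p arc :=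
  ⟨hf.of_le (hm.aestronglyMeasurable.mul hf.aestronglyMeasurable)
      (Eventually.of_forall fun z => by simp [hw]),
    eLpNorm_congr_norm_ae (Eventually.of_forall fun z => by simp [hw])⟩

/-- Multiplication by a unimodular function on `L^p` of the circle. -/
def unimodularMul (p : ℝ≥0∞) [Fact (1 ≤ p)] (w : Circle → ℂ) (hm : Measurable w)
    (hw : ∀ z, ‖w z‖ = 1) : Lp ℂ p arc →ₗᵢ[ℂ] Lp ℂ p arc :=
  mulIsometry w Measure.AbsolutelyContinuous.rfl (memLp_unimodular_mul hm hw)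

theorem coeFn_unimodularMul {p : ℝ≥0∞} [Fact (1 ≤ p)] {w : Circle → ℂ} (hm : Measurable w)
    (hw : ∀ z, ‖w z‖ = 1) (f : Lp ℂ p arc) :
    unimodularMul p w hm hw f =ᵐ[arc] fun z => w z * f z :=
  coeFn_mulIsometry _ _ f

theorem measurable_coe_circle : Measurable fun z : Circle => (z : ℂ) :=
  (by fun_prop : Continuous fun z : Circle => (z : ℂ)).measurable

theorem HasRep.unimodularMul_mem {p : ℝ≥0∞} [Fact (1 ≤ p)] {M : Submodule ℂ (Lp ℂ p arc)}
    {w : Circle → ℂ} {hm : Measurable w} {hw : ∀ z, ‖w z‖ = 1} {f : Lp ℂ p arc} :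
    unimodularMul p w hm hw f ∈ M ↔ HasRep M (fun z => w z * f z) :=
  ⟨fun h => ⟨_, h, coeFn_unimodularMul hm hw f⟩,
    fun h => (h.congr (coeFn_unimodularMul hm hw f).symm).mem⟩

theorem ZInvariant.topologicalClosure {p : ℝ≥0∞} [Fact (1 ≤ p)] {M : Submodule ℂ (Lp ℂ p arc)}
    (hz : ZInvariant (M : Set (Lp ℂ p arc))) :
    ZInvariant (M.topologicalClosure : Set (Lp ℂ p arc)) := by
  intro f hf
  let T := unimodularMul p (fun z : Circle => (z : ℂ)) measurable_coe_circle Circle.norm_coe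
  refine ⟨T f, ?_, coeFn_unimodularMul _ _ f⟩
  refine map_mem_closure T.continuous hf fun g hg => ?_
  exact HasRep.unimodularMul_mem.2 ((HasRep.of_mem hg).zmul hz)

-- Invariant subspaces of `L²`

section Hilbert

variable {K : Submodule ℂ (Lp ℂ 2 arc)}

theorem integrable_conj_mul {f g : Circle → ℂ} (hf : MemLp f 2 arc) (hg : MemLp g 2 arc) :
    Integrable (fun z => conj (f z) * g z) arc := by
  have := hf.star.integrable_mul hg
  exact this

/-- Orthogonal decomposition of a square integrable function. -/
theorem exists_orthogonal_decomposition (hK : IsClosed (K : Set (Lp ℂ 2 arc))) {f : Circle → ℂ}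
    (hf : MemLp f 2 arc) :
    ∃ g r : Circle → ℂ, Measurable g ∧ HasRep K g ∧ MemLp r 2 arc ∧ f =ᵐ[arc] g + r ∧
      ∀ h, HasRep K h → ∫ z, conj (r z) * h z ∂arc = 0 := by
  have : CompleteSpace K := hK.completeSpace_coe
  set F := hf.toLp f with hF
  let g : Lp ℂ 2 arc := K.starProjection F
  have hr : F - g ∈ Kᗮ := K.sub_starProjection_mem_orthogonal F
  refine ⟨g, (F - g : Lp ℂ 2 arc), (Lp.stronglyMeasurable g).measurable,
    HasRep.of_mem (K.starProjection_apply_mem F), Lp.memLp _, ?_, ?_⟩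
  · filter_upwards [hf.coeFn_toLp, Lp.coeFn_sub F g] with z h1 h2
    rw [Pi.add_apply, h2, Pi.sub_apply, add_sub_cancel, hF, h1]
  · rintro h ⟨h', hK', hh⟩
    have h1 := (K.mem_orthogonal' _).1 hr h' hK'
    rw [L2.inner_def] at h1
    rw [← h1]
    refine integral_congr_ae ?_
    filter_upwards [hh] with z hz
    rw [RCLike.inner_apply, hz, mul_comm]

theorem integral_conj_eq_zero {f : Circle → ℂ} (h : ∫ z, f z ∂arc = 0) :
    ∫ z, conj (f z) ∂arc = 0 := by
  rw [integral_conj, h, map_zero]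

/-- The condition says that `conj φ · f` has no negative frequencies, that is, `f ∈ φH²`. For
sufficiency, let `r` be the part of `f` orthogonal to `K`. The integrals of `conj φ · r · z^n`
vanish for `n ≤ 0` because `r` is orthogonal to `z^m φ`, and for `n > 0` because they vanish for `f`
and for its projection. Hence `r = 0`. -/
theorem hasRep_iff_of_wandering (hK : IsClosed (K : Set (Lp ℂ 2 arc)))
    (hz : ZInvariant (K : Set (Lp ℂ 2 arc))) {φ : Circle → ℂ}
    (hφ : ∀ z, ‖φ z‖ = 1) (hφK : HasRep K φ)
    (horth : ∀ h, HasRep K h → ∫ z : Circle, conj (φ z) * ((z : ℂ) * h z) ∂arc = 0)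
    {f : Circle → ℂ} (hf : MemLp f 2 arc) :
    HasRep K f ↔ ∀ n : ℕ, ∫ z : Circle, conj (φ z) * ((z : ℂ) ^ (n + 1) * f z) ∂arc = 0 := by
  have hfwd : ∀ f, HasRep K f →
      ∀ n : ℕ, ∫ z : Circle, conj (φ z) * ((z : ℂ) ^ (n + 1) * f z) ∂arc = 0 := by
    intro f h n
    have := horth _ (h.pow_mul hz n)
    simpa only [pow_succ', mul_assoc] using this
  refine ⟨hfwd f, fun h => ?_⟩
  obtain ⟨g, r, -, hg, hr, hfgr, hrK⟩ := exists_orthogonal_decomposition hK hf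
  have hφL := hφK.memLp
  have hpow : ∀ (n : ℕ) {f : Circle → ℂ}, MemLp f 2 arc →
      MemLp (fun z : Circle => (z : ℂ) ^ n * f z) 2 arc := fun n f hf =>
    (memLp_unimodular_mul (measurable_coe_circle.pow_const n)
      (fun z => by rw [norm_pow, Circle.norm_coe, one_pow]) f hf).1
  have h0 : (fun z => conj (φ z) * r z) =ᵐ[arc] 0 := by
    refine ae_eq_zero_of_fourier (integrable_conj_mul hφL hr) fun n => ?_
    rcases le_or_gt n 0 with hn | hn
    · obtain ⟨m, rfl⟩ := Int.exists_eq_neg_ofNat hn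
      have := integral_conj_eq_zero (hrK _ (hφK.pow_mul hz m))
      rw [← this]
      congr 1
      ext z
      have h1 := conj_zpow_circle m z
      rw [zpow_natCast] at h1
      simp only [map_mul, Complex.conj_conj, h1]
      ring
    · obtain ⟨m, rfl⟩ : ∃ m : ℕ, n = ((m + 1 : ℕ) : ℤ) := ⟨(n - 1).toNat, by omega⟩
      have h1 := h m
      have h2 := hfwd g hg m
      have h3 : ∫ z : Circle, conj (φ z) * ((z : ℂ) ^ (m + 1) * f z) ∂arc =
          ∫ z : Circle, (conj (φ z) * ((z : ℂ) ^ (m + 1) * g z) +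
            conj (φ z) * ((z : ℂ) ^ (m + 1) * r z)) ∂arc := by
        refine integral_congr_ae ?_
        filter_upwards [hfgr] with z hz
        rw [hz, Pi.add_apply]
        ring
      rw [h1, integral_add (integrable_conj_mul hφL (hpow _ hg.memLp))
        (integrable_conj_mul hφL (hpow _ hr)), h2, zero_add] at h3
      rw [h3]
      congr 1
      ext z
      rw [zpow_natCast]
      ring
  refine hg.congr ?_
  filter_upwards [h0, hfgr] with z h1 h2
  have h3 : φ z ≠ 0 := fun h => by simpa [h] using hφ z
  have h4 : r z = 0 := by simpa [h3] using h1
  rw [h2, Pi.add_apply, h4, add_zero]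

/-- For `r` orthogonal to `K` and `h ∈ K`, invariance under all powers of `z` kills every Fourier
coefficient of `conj r · h`, so orthogonality is pointwise. Write `1 = q + r` with `q` the
projection to `K`. Where `q = 0`, `r = 1` and all of `K` vanishes; where `q ≠ 0`, everything
orthogonal to `K` vanishes. So `E = {q ≠ 0}`. -/
theorem exists_support_of_reducing (hK : IsClosed (K : Set (Lp ℂ 2 arc)))
    (hz : ∀ (n : ℤ) f, HasRep K f → HasRep K (fun z : Circle => (z : ℂ) ^ n * f z)) :
    ∃ E : Set Circle, MeasurableSet E ∧ ∀ f, MemLp f 2 arc →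
      (HasRep K f ↔ ∀ᵐ z ∂arc, z ∉ E → f z = 0) := by
  have hann : ∀ r h : Circle → ℂ, MemLp r 2 arc → HasRep K h →
      (∀ h, HasRep K h → ∫ z, conj (r z) * h z ∂arc = 0) →
      (fun z => conj (r z) * h z) =ᵐ[arc] 0 := by
    intro r h hr hh hrK
    refine ae_eq_zero_of_fourier (integrable_conj_mul hr hh.memLp) fun n => ?_
    rw [← hrK _ (hz n h hh)]
    congr 1
    ext z
    ring
  obtain ⟨q, r, hqm, hq, hr, hqr, hrK⟩ := exists_orthogonal_decomposition hK
    (f := fun _ => (1 : ℂ)) (memLp_const 1)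
  have hoff : ∀ f, HasRep K f → ∀ᵐ z ∂arc, q z = 0 → f z = 0 := by
    intro f hf
    filter_upwards [hann r f hr hf hrK, hqr] with z h1 h2 h3
    rw [Pi.add_apply, h3, zero_add] at h2
    simpa [← h2] using h1
  refine ⟨{z | q z ≠ 0}, (hqm (measurableSet_singleton 0)).compl, fun f hf => ⟨fun h => ?_,
    fun h => ?_⟩⟩
  · filter_upwards [hoff f h] with z hz' h'
    exact hz' (by simpa using h')
  · obtain ⟨g, s, -, hg, hs, hfgs, hsK⟩ := exists_orthogonal_decomposition hK hf
    refine hg.congr ?_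
    filter_upwards [hann s q hs hq hsK, hoff g hg, h, hfgs] with z h1 h2 h3 h4
    by_cases hqz : q z = 0
    · rw [h2 hqz, h3 (by simpa using hqz)]
    · have h5 : s z = 0 := by simpa [hqz] using h1
      rw [h4, Pi.add_apply, h5, add_zero]

/-- A function orthogonal to its own shifts has constant modulus. -/
theorem exists_normSq_ae_eq (hz : ZInvariant (K : Set (Lp ℂ 2 arc))) {r : Circle → ℂ}
    (hrr : HasRep K r)
    (horth : ∀ h, HasRep K h → ∫ z : Circle, conj (r z) * ((z : ℂ) * h z) ∂arc = 0) :
    ∃ c : ℂ, ∀ᵐ z ∂arc, ((‖r z‖ ^ 2 : ℝ) : ℂ) = c := by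
  have hr := hrr.memLp
  set c : ℂ := ∫ z, conj (r z) * r z ∂arc with hc
  have hconst : (fun z => conj (r z) * r z - c) =ᵐ[arc] 0 := by
    have hi := integrable_conj_mul hr hr
    -- Orthogonality to the shifts handles the frequencies of one sign; conjugation handles the
    -- other, as `|r|²` is real. Subtracting the mean `c` handles frequency zero.
    have hbase : ∀ m : ℕ,
        ∫ z : Circle, conj (r z) * r z * (z : ℂ) ^ ((m + 1 : ℕ) : ℤ) ∂arc = 0 := by
      intro m
      rw [← horth _ (hrr.pow_mul hz m)]
      congr 1
      ext z
      rw [zpow_natCast]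
      ring
    refine ae_eq_zero_of_fourier (hi.sub (integrable_const c)) fun n => ?_
    have hzn : ∀ n : ℤ, Integrable (fun z : Circle => conj (r z) * r z * (z : ℂ) ^ n) arc := by
      intro n
      refine hi.mul_bdd (c := 1) ((monomialMap n).continuous.congr
        (monomialMap_apply n)).aestronglyMeasurable (Eventually.of_forall fun z => by
          rw [norm_zpow, Circle.norm_coe, one_zpow])
    have hzn' : Integrable (fun z : Circle => c * (z : ℂ) ^ n) arc :=
      (integrable_of_continuous_arc ((monomialMap n).continuous.congr
        (monomialMap_apply n))).const_mul c
    simp only [sub_mul]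
    rw [integral_sub (hzn n) hzn', integral_const_mul]
    rcases lt_trichotomy n 0 with hn | rfl | hn
    · obtain ⟨m, rfl⟩ : ∃ m : ℕ, n = -((m + 1 : ℕ) : ℤ) := ⟨(-n - 1).toNat, by omega⟩
      rw [integral_zpow_arc hn.ne, mul_zero, sub_zero, ← integral_conj_eq_zero (hbase m)]
      congr 1
      ext z
      rw [map_mul, map_mul, conj_zpow_circle, Complex.conj_conj]
      ring
    · simp [hc]
    · obtain ⟨m, rfl⟩ : ∃ m : ℕ, n = ((m + 1 : ℕ) : ℤ) := ⟨(n - 1).toNat, by omega⟩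
      rw [integral_zpow_arc hn.ne', hbase m, mul_zero, sub_zero]
  refine ⟨c, ?_⟩
  filter_upwards [hconst] with z hcz
  rw [Complex.ofReal_pow, ← Complex.conj_mul', sub_eq_zero.1 hcz]

/-- Closed `z`-invariant subspaces of `L²`. -/
theorem invariant_subspace_two (hK : IsClosed (K : Set (Lp ℂ 2 arc)))
    (hz : ZInvariant (K : Set (Lp ℂ 2 arc))) :
    (∃ E : Set Circle, MeasurableSet E ∧ ∀ f, MemLp f 2 arc →
      (HasRep K f ↔ ∀ᵐ z ∂arc, z ∉ E → f z = 0)) ∨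
    (∃ φ : Circle → ℂ, Measurable φ ∧ (∀ z, ‖φ z‖ = 1) ∧ ∀ f, MemLp f 2 arc →
      (HasRep K f ↔
        ∀ n : ℕ, ∫ z : Circle, conj (φ z) * ((z : ℂ) ^ (n + 1) * f z) ∂arc = 0)) := by
  have hcm : Measurable fun z : Circle => conj (z : ℂ) :=
    Complex.continuous_conj.measurable.comp measurable_coe_circle
  have hzz : ∀ z : Circle, (z : ℂ) * conj (z : ℂ) = 1 := fun z => by
    rw [Complex.mul_conj, Circle.normSq_coe, Complex.ofReal_one]
  have hc1 : ∀ z : Circle, ‖conj (z : ℂ)‖ = 1 := fun z => by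
    rw [RCLike.norm_conj, Circle.norm_coe]
  let T := unimodularMul 2 (fun z : Circle => conj (z : ℂ)) hcm hc1
  -- This is `zK`, written as a preimage so that it is visibly closed. Since `zK ⊆ K`, the inclusion
  -- `K ≤ K'` means `zK = K`.
  let K' : Submodule ℂ (Lp ℂ 2 arc) := K.comap T.toLinearMap
  have hmem : ∀ h, h ∈ K' ↔ HasRep K (fun z : Circle => conj (z : ℂ) * h z) := fun h =>
    Submodule.mem_comap.trans (HasRep.unimodularMul_mem (hm := hcm) (hw := hc1))
  have hK' : IsClosed (K' : Set (Lp ℂ 2 arc)) := hK.preimage T.continuous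
  by_cases hred : K ≤ K'
  · left
    have hconj : ∀ f, HasRep K f → HasRep K (fun z : Circle => conj (z : ℂ) * f z) := by
      rintro f ⟨h, hh, hhf⟩
      refine ((hmem h).1 (hred hh)).congr ?_
      filter_upwards [hhf] with z hz'
      rw [hz']
    refine exists_support_of_reducing hK fun n f hf => ?_
    rcases n.eq_nat_or_neg with ⟨m, rfl | rfl⟩
    · simpa only [zpow_natCast] using hf.pow_mul hz m
    · simp only [← conj_zpow_circle, zpow_natCast, map_pow]
      induction m with
      | zero => simpa using hf
      | succ m ih => simpa only [pow_succ', mul_assoc] using hconj _ ih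
  · right
    -- The wandering vector is the component `r`, orthogonal to `zK`, of some `f ∈ K` outside `zK`.
    -- It stays in `K` because the other component is in `zK ⊆ K`.
    obtain ⟨f, hfK, hfK'⟩ := SetLike.not_le_iff_exists.1 hred
    obtain ⟨g, r, -, hg, hr, hfgr, hrK⟩ := exists_orthogonal_decomposition hK' (Lp.memLp f)
    have hzK' : ∀ h, HasRep K h → HasRep K' (fun z : Circle => (z : ℂ) * h z) := by
      intro h hh
      have hL := (hh.zmul hz).memLp
      refine ⟨hL.toLp _, ?_, hL.coeFn_toLp⟩
      refine (hmem _).2 (hh.congr ?_)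
      filter_upwards [hL.coeFn_toLp] with z hz'
      rw [hz', ← mul_assoc, mul_comm (conj (z : ℂ)), hzz, one_mul]
    have hgK : HasRep K g := by
      obtain ⟨g', hg', hgg⟩ := hg
      refine (((hmem g').1 hg').zmul hz).congr ?_
      filter_upwards [hgg] with z hz'
      rw [← mul_assoc, hzz, one_mul, hz']
    have hrr : HasRep K r := by
      refine ((HasRep.of_mem hfK).add (hgK.const_mul (-1))).congr ?_
      filter_upwards [hfgr] with z hz'
      rw [Pi.add_apply, hz', Pi.add_apply]
      ring
    have horth : ∀ h, HasRep K h → ∫ z : Circle, conj (r z) * ((z : ℂ) * h z) ∂arc = 0 :=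
      fun h hh => hrK _ (hzK' h hh)
    obtain ⟨c, hsq⟩ := exists_normSq_ae_eq hz hrr horth
    have hc0 : c ≠ 0 := by
      intro h0
      refine hfK' (hg.congr ?_).mem
      filter_upwards [hfgr, hsq] with z h1 h2
      have h3 : r z = 0 := by
        rw [h0] at h2
        simpa using h2
      rw [h1, Pi.add_apply, h3, add_zero]
    obtain ⟨a, ha, hra⟩ : ∃ a : ℝ, 0 < a ∧ ∀ᵐ z ∂arc, ‖r z‖ = a := by
      obtain ⟨z₀, hz₀⟩ := hsq.exists
      refine ⟨‖r z₀‖, norm_pos_iff.2 fun h => hc0 (by simpa [h] using hz₀.symm), ?_⟩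
      filter_upwards [hsq] with z h1
      have h2 : ‖r z‖ ^ 2 = ‖r z₀‖ ^ 2 := by exact_mod_cast h1.trans hz₀.symm
      exact (sq_eq_sq₀ (norm_nonneg _) (norm_nonneg _)).1 h2
    obtain ⟨r', hr'm, hrr'⟩ := hr.aestronglyMeasurable.aemeasurable
    -- The value `1` on the exceptional null set makes `φ` unimodular everywhere.
    let φ : Circle → ℂ := fun z => if ‖r' z‖ = a then (a : ℂ)⁻¹ * r' z else 1
    have hφr : φ =ᵐ[arc] fun z => (a : ℂ)⁻¹ * r z := by
      filter_upwards [hra, hrr'] with z h1 h2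
      simp only [φ, ← h2, h1, if_true]
    have hφm : Measurable φ := Measurable.ite
      (hr'm.norm (measurableSet_singleton a)) (hr'm.const_mul _) measurable_const
    have hφ1 : ∀ z, ‖φ z‖ = 1 := by
      intro z
      simp only [φ]
      split_ifs with h
      · rw [norm_mul, h, norm_inv, Complex.norm_real, Real.norm_of_nonneg ha.le,
          inv_mul_cancel₀ ha.ne']
      · simp
    refine ⟨φ, hφm, hφ1, fun f hf => hasRep_iff_of_wandering hK hz hφ1
      ((hrr.const_mul _).congr hφr.symm) (fun h hh => ?_) hf⟩
    have h1 := horth h hh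
    calc ∫ z : Circle, conj (φ z) * ((z : ℂ) * h z) ∂arc
        = ∫ z : Circle, (a : ℂ)⁻¹ * (conj (r z) * ((z : ℂ) * h z)) ∂arc := by
          refine integral_congr_ae ?_
          filter_upwards [hφr] with z hz'
          rw [hz', map_mul, map_inv₀, Complex.conj_ofReal, mul_assoc]
      _ = 0 := by rw [integral_const_mul, h1, mul_zero]

end Hilbert

-- Passage between `L²` and `L^p`

section Density

variable {p : ℝ≥0∞} {M : Submodule ℂ (Lp ℂ p arc)}

/-- The elements of `L²` which represent elements of `M`. -/
def squareIntegrablePart (M : Submodule ℂ (Lp ℂ p arc)) : Submodule ℂ (Lp ℂ 2 arc) where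
  carrier := {f | HasRep M f}
  add_mem' {f g} hf hg := HasRep.congr (HasRep.add hf hg) (Lp.coeFn_add f g).symm
  zero_mem' := HasRep.zero.congr (Lp.coeFn_zero _ _ _).symm
  smul_mem' c f hf := by
    refine HasRep.congr (HasRep.const_mul c hf) ?_
    filter_upwards [Lp.coeFn_smul c f] with z hz
    simp [hz]

theorem zInvariant_squareIntegrablePart (hz : ZInvariant (M : Set (Lp ℂ p arc))) :
    ZInvariant (squareIntegrablePart M : Set (Lp ℂ 2 arc)) := by
  intro f hf
  have hL := (memLp_unimodular_mul measurable_coe_circle Circle.norm_coe f (Lp.memLp f)).1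
  exact ⟨hL.toLp _, (HasRep.zmul hz hf).congr hL.coeFn_toLp.symm, hL.coeFn_toLp⟩

variable [Fact (1 ≤ p)]

/-- A closed invariant subspace of `L^p` is closed in `L^p` under fast `L¹` convergence. -/
theorem HasRep.of_tsum_lintegral (hp : p ≠ ∞) (hM : IsClosed (M : Set (Lp ℂ p arc)))
    (hz : ZInvariant (M : Set (Lp ℂ p arc))) {f : ℕ → Circle → ℂ} {g : Circle → ℂ}
    (hf : ∀ n, HasRep M (f n)) (hg : MemLp g p arc)
    (hsum : ∑' n, ∫⁻ z, ‖f n z - g z‖ₑ ∂arc ≠ ∞) : HasRep M g := by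
  have hm : ∀ n, AEMeasurable (fun z => ‖f n z - g z‖ₑ) arc := fun n =>
    ((hf n).memLp.aestronglyMeasurable.sub hg.aestronglyMeasurable).enorm
  rw [← lintegral_tsum hm] at hsum
  have hSm : AEMeasurable (fun z => ∑' n, ‖f n z - g z‖ₑ) arc := AEMeasurable.tsum hm
  have hfin : ∀ᵐ z ∂arc, ∑' n, ‖f n z - g z‖ₑ < ∞ := ae_lt_top' hSm hsum
  have hgi : Integrable g arc := hg.integrable Fact.out
  -- This `F` dominates every `f n`, so `k m * f n` is bounded by `C m` uniformly in `n`. Letting `n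
  -- → ∞` puts `k m * g` in `M`; then `m → ∞` gives `g`.
  obtain ⟨k, C, hkM, hk1, hkF, hklim⟩ := exists_truncating_multipliers hp hM hz
    (F := fun z => (∑' n, ‖f n z - g z‖ₑ).toReal + ‖g z‖)
    ((integrable_toReal_of_lintegral_ne_top hSm hsum).add hgi.norm)
    (fun z => by positivity)
  have hkg : ∀ m, HasRep M (fun z => k m z * g z) := by
    intro m
    refine HasRep.of_dominated hp hM (fun n => hkM m _ (hf n)) (memLp_const (C m)) (fun n => ?_) ?_
    · filter_upwards [hfin, hkF m] with z h1 h2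
      rw [norm_mul]
      refine (mul_le_mul_of_nonneg_left ?_ (norm_nonneg _)).trans h2
      have h3 : ‖f n z - g z‖ ≤ (∑' n, ‖f n z - g z‖ₑ).toReal := by
        rw [← toReal_enorm]
        exact ENNReal.toReal_mono h1.ne (ENNReal.le_tsum n)
      calc ‖f n z‖ = ‖(f n z - g z) + g z‖ := by rw [sub_add_cancel]
        _ ≤ _ := (norm_add_le _ _).trans (by gcongr)
    · filter_upwards [hfin] with z h1
      refine Tendsto.const_mul _ ?_
      have h2 := ENNReal.tendsto_atTop_zero_of_tsum_ne_top h1.ne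
      rw [tendsto_iff_edist_tendsto_0]
      simpa only [edist_eq_enorm_sub] using h2
  refine HasRep.of_dominated hp hM hkg hg.norm (fun m => ?_) ?_
  · filter_upwards [hk1 m] with z h1
    rw [norm_mul]
    exact mul_le_of_le_one_left (norm_nonneg _) h1
  · filter_upwards [hklim] with z h1
    simpa using h1.mul_const (g z)

/-- On a probability space the `L²` distance bounds the `L¹` distance, so approximants within
`2^{-n}` in `L²` have summable `L¹` errors. -/
theorem HasRep.of_closure_squareIntegrablePart (hp : p ≠ ∞)
    (hM : IsClosed (M : Set (Lp ℂ p arc))) (hz : ZInvariant (M : Set (Lp ℂ p arc)))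
    {g : Circle → ℂ} (hg : HasRep (squareIntegrablePart M).topologicalClosure g)
    (hgp : MemLp g p arc) : HasRep M g := by
  obtain ⟨g', hg', hgg⟩ := hg
  have h1 : ∀ n : ℕ, ∃ f ∈ squareIntegrablePart M, edist g' f < (1 / 2) ^ n := fun n =>
    EMetric.mem_closure_iff.1 hg' _ (ENNReal.pow_pos (by simp) n)
  choose f hf hd using h1
  refine HasRep.of_tsum_lintegral hp hM hz (f := fun n => f n) hf hgp ?_
  have h2 : ∀ n, ∫⁻ z, ‖f n z - g z‖ₑ ∂arc ≤ (1 / 2) ^ n := by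
    intro n
    calc ∫⁻ z, ‖f n z - g z‖ₑ ∂arc = eLpNorm (⇑g' - ⇑(f n)) 1 arc := by
          rw [eLpNorm_one_eq_lintegral_enorm]
          refine lintegral_congr_ae ?_
          filter_upwards [hgg] with z hz'
          rw [Pi.sub_apply, hz', enorm_sub_rev]
      _ ≤ eLpNorm (⇑g' - ⇑(f n)) 2 arc := eLpNorm_le_eLpNorm_of_exponent_le (by norm_num)
          ((Lp.aestronglyMeasurable g').sub (Lp.aestronglyMeasurable (f n)))
      _ = edist g' (f n) := (Lp.edist_def g' (f n)).symm
      _ ≤ _ := (hd n).le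
  refine ne_top_of_le_ne_top ?_ (ENNReal.tsum_le_tsum h2)
  rw [ENNReal.tsum_geometric]
  simp

/-- The approximants are `k n * f`, with the truncating multipliers of `F = |f|`. They carry
information on bounded elements of the `L²`-closure over to all of `M`. -/
theorem HasRep.exists_bounded_approx (hp : p ≠ ∞) (hM : IsClosed (M : Set (Lp ℂ p arc)))
    (hz : ZInvariant (M : Set (Lp ℂ p arc))) {f : Circle → ℂ} (hf : HasRep M f) :
    ∃ g : ℕ → Circle → ℂ, (∀ n, HasRep (squareIntegrablePart M).topologicalClosure (g n)) ∧
      (∀ n, MemLp (g n) ∞ arc) ∧ (∀ n, ∀ᵐ z ∂arc, ‖g n z‖ ≤ ‖f z‖) ∧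
      ∀ᵐ z ∂arc, Tendsto (fun n => g n z) atTop (𝓝 (f z)) := by
  have hfi : Integrable f arc := hf.memLp.integrable Fact.out
  obtain ⟨k, C, hkM, hk1, hkF, hklim⟩ := exists_truncating_multipliers hp hM hz hfi.norm
    (fun z => norm_nonneg _)
  have hb : ∀ n, MemLp (fun z => k n z * f z) ∞ arc := fun n =>
    memLp_top_of_bound (hkM n f hf).memLp.aestronglyMeasurable (C n) (by
      filter_upwards [hkF n] with z h1
      rwa [norm_mul])
  refine ⟨fun n z => k n z * f z, fun n => ?_, hb, fun n => ?_, ?_⟩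
  · have h2 : MemLp (fun z => k n z * f z) 2 arc := (hb n).mono_exponent le_top
    exact ⟨h2.toLp _, Submodule.le_topologicalClosure _
      ((hkM n f hf).congr h2.coeFn_toLp.symm), h2.coeFn_toLp⟩
  · filter_upwards [hk1 n] with z h1
    rw [norm_mul]
    exact mul_le_of_le_one_left (norm_nonneg _) h1
  · filter_upwards [hklim] with z h1
    simpa using h1.mul_const (f z)

end Density

-- Bounded functions in `H^p`

section Hardy

variable (p : ℝ≥0∞)

/-- The polynomials in `z`, as a subspace of `L^p`. -/
def polynomialSubmodule : Submodule ℂ (Lp ℂ p arc) where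
  carrier := {f | ∃ P : ℂ[X], ∀ᵐ z ∂arc, f z = P.eval (z : ℂ)}
  add_mem' := by
    rintro f g ⟨P, hP⟩ ⟨Q, hQ⟩
    refine ⟨P + Q, ?_⟩
    filter_upwards [hP, hQ, Lp.coeFn_add f g] with z h1 h2 h3
    rw [h3, Pi.add_apply, h1, h2, eval_add]
  zero_mem' := by
    refine ⟨0, ?_⟩
    filter_upwards [Lp.coeFn_zero ℂ p arc] with z hz
    rw [hz, eval_zero, Pi.zero_apply]
  smul_mem' := by
    rintro c f ⟨P, hP⟩
    refine ⟨C c * P, ?_⟩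
    filter_upwards [hP, Lp.coeFn_smul c f] with z h1 h2
    rw [h2, Pi.smul_apply, h1, Polynomial.eval_mul, eval_C, smul_eq_mul]

variable [Fact (1 ≤ p)]

/-- The Hardy space `H^p` as a subspace of `L^p`. -/
def hardySubmodule : Submodule ℂ (Lp ℂ p arc) := (polynomialSubmodule p).topologicalClosure

theorem isClosed_hardySubmodule : IsClosed (hardySubmodule p : Set (Lp ℂ p arc)) :=
  Submodule.isClosed_topologicalClosure _

theorem zInvariant_hardySubmodule : ZInvariant (hardySubmodule p : Set (Lp ℂ p arc)) := by
  refine ZInvariant.topologicalClosure fun f hf => ?_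
  obtain ⟨P, hP⟩ := hf
  have hL := (memLp_unimodular_mul measurable_coe_circle Circle.norm_coe f (Lp.memLp f)).1
  refine ⟨hL.toLp _, ⟨X * P, ?_⟩, hL.coeFn_toLp⟩
  filter_upwards [hP, hL.coeFn_toLp] with z h1 h2
  rw [h2, h1, Polynomial.eval_mul, eval_X]

variable {p}

theorem hasRep_hardySubmodule_eval (P : ℂ[X]) :
    HasRep (hardySubmodule p) (fun z => P.eval (z : ℂ)) := by
  have hL := memLp_of_continuous_arc (continuous_eval_circle P) p
  exact ⟨hL.toLp _, Submodule.le_topologicalClosure _ ⟨P, hL.coeFn_toLp⟩, hL.coeFn_toLp⟩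

/-- Functions in `H²` are orthogonal to the negative powers of `z`. -/
theorem integral_mul_eq_zero_of_hardy_two {h : Circle → ℂ} (hh : HasRep (hardySubmodule 2) h) :
    ∫ z : Circle, conj (1 : ℂ) * ((z : ℂ) * h z) ∂arc = 0 := by
  obtain ⟨h', hh', hhh⟩ := hh
  have hL : MemLp (fun z : Circle => conj (z : ℂ)) 2 arc :=
    memLp_of_continuous_arc (by fun_prop) 2
  -- As an inner product with `conj z` the integral is continuous in `f`, so it suffices to check
  -- polynomials. The factor `conj 1` matches the hypothesis of `hasRep_iff_of_wandering` for `φ =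
  -- 1`.
  have hin : ∀ f : Lp ℂ 2 arc,
      inner ℂ (hL.toLp _) f = ∫ z : Circle, conj (1 : ℂ) * ((z : ℂ) * f z) ∂arc := by
    intro f
    rw [L2.inner_def]
    refine integral_congr_ae ?_
    filter_upwards [hL.coeFn_toLp] with z hz
    rw [RCLike.inner_apply, hz, Complex.conj_conj, map_one, one_mul, mul_comm]
  have hcl : IsClosed {f : Lp ℂ 2 arc | inner ℂ (hL.toLp _) f = 0} :=
    isClosed_eq (by fun_prop) continuous_const
  have hmem : h' ∈ {f : Lp ℂ 2 arc | inner ℂ (hL.toLp _) f = 0} := by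
    refine closure_minimal ?_ hcl hh'
    rintro f ⟨P, hP⟩
    rw [Set.mem_ofPred_eq, hin]
    have h1 := integral_eval_arc (X * P)
    rw [Polynomial.eval_mul, eval_X, zero_mul] at h1
    rw [← h1]
    refine integral_congr_ae ?_
    filter_upwards [hP] with z hz
    rw [hz, map_one, one_mul, Polynomial.eval_mul, eval_X]
  rw [Set.mem_ofPred_eq, hin] at hmem
  rw [← hmem]
  refine integral_congr_ae ?_
  filter_upwards [hhh] with z hz
  rw [hz]

/-- A bounded function with vanishing negative Fourier coefficients belongs to `H^p`. -/
theorem hasRep_hardySubmodule_of_bounded (hp : p ≠ ∞) {g : Circle → ℂ} (hg : MemLp g ∞ arc)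
    (h : ∀ n : ℕ, ∫ z : Circle, (z : ℂ) ^ (n + 1) * g z ∂arc = 0) :
    HasRep (hardySubmodule p) g := by
  have h2 : HasRep (hardySubmodule 2) g := by
    have hone : HasRep (hardySubmodule 2) (fun _ => (1 : ℂ)) := by
      simpa using hasRep_hardySubmodule_eval (p := 2) 1
    refine (hasRep_iff_of_wandering (isClosed_hardySubmodule 2) (zInvariant_hardySubmodule 2)
      (φ := fun _ => 1) (by simp) hone (fun h hh => integral_mul_eq_zero_of_hardy_two hh)
      (hg.mono_exponent le_top)).2 fun n => ?_
    simpa using h n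
  -- Polynomials are square integrable elements of `H^p`, so `H²` lies in the `L²`-closure of the
  -- square integrable part of `H^p`.
  refine HasRep.of_closure_squareIntegrablePart hp (isClosed_hardySubmodule p)
    (zInvariant_hardySubmodule p) ?_ (hg.mono_exponent le_top)
  obtain ⟨g', hg', hgg⟩ := h2
  refine ⟨g', ?_, hgg⟩
  refine Submodule.topologicalClosure_mono ?_ hg'
  rintro f ⟨P, hP⟩
  exact (hasRep_hardySubmodule_eval P).congr (EventuallyEq.symm hP)

end Hardy

-- Classification in `L^p` of arc length

/-- Closed `z`-invariant subspaces of `L^p` of the circle, for `1 ≤ p < ∞`. -/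
theorem invariant_subspace {p : ℝ≥0∞} [Fact (1 ≤ p)] (hp : p ≠ ∞) {M : Submodule ℂ (Lp ℂ p arc)}
    (hM : IsClosed (M : Set (Lp ℂ p arc))) (hz : ZInvariant (M : Set (Lp ℂ p arc))) :
    (∃ E : Set Circle, MeasurableSet E ∧ ∀ f, HasRep M f ↔
      MemLp f p arc ∧ ∀ᵐ z ∂arc, z ∉ E → f z = 0) ∨
    (∃ φ : Circle → ℂ, Measurable φ ∧ (∀ z, ‖φ z‖ = 1) ∧ ∀ f, HasRep M f ↔
      HasRep (hardySubmodule p) (fun z => conj (φ z) * f z)) := by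
  rcases invariant_subspace_two (Submodule.isClosed_topologicalClosure (squareIntegrablePart M))
    (zInvariant_squareIntegrablePart hz).topologicalClosure with
    ⟨E, hE, h⟩ | ⟨φ, hφm, hφ, h⟩
  · refine Or.inl ⟨E, hE, fun f => ⟨fun hf => ⟨hf.memLp, ?_⟩, fun ⟨hf, hf0⟩ => ?_⟩⟩
    · obtain ⟨g, hgK, hgb, -, hlim⟩ := hf.exists_bounded_approx hp hM hz
      have h0 : ∀ᵐ z ∂arc, ∀ n, z ∉ E → g n z = 0 :=
        ae_all_iff.2 fun n => (h _ ((hgb n).mono_exponent le_top)).1 (hgK n)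
      filter_upwards [h0, hlim] with z h1 h2 hzE
      simp only [fun n => h1 n hzE] at h2
      exact tendsto_nhds_unique h2 tendsto_const_nhds
    · obtain ⟨f', hf'm, hff'⟩ := hf.aestronglyMeasurable.aemeasurable
      have hf' : MemLp f' p arc := (memLp_congr_ae hff').1 hf
      refine HasRep.congr ?_ hff'.symm
      -- Cutting off at height `n` suffices here, as it preserves vanishing off `E`; no analytic
      -- truncation is needed.
      let g : ℕ → Circle → ℂ := fun n => {z | ‖f' z‖ ≤ n}.indicator f'
      have hgm : ∀ n, Measurable (g n) := fun n =>
        hf'm.indicator (measurableSet_le hf'm.norm measurable_const)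
      have hgle : ∀ n z, ‖g n z‖ ≤ ‖f' z‖ := fun n z => norm_indicator_le_norm_self _ _
      have hgb : ∀ n, MemLp (g n) ∞ arc := fun n =>
        memLp_top_of_bound (hgm n).aestronglyMeasurable n (Eventually.of_forall fun z => by
          by_cases hz' : z ∈ {z | ‖f' z‖ ≤ n}
          · simpa [g, Set.indicator_of_mem hz'] using hz'
          · simp [g, Set.indicator_of_notMem hz'])
      refine HasRep.of_dominated hp hM (f := g) (fun n => ?_) hf'.norm
        (fun n => Eventually.of_forall fun z => hgle n z) (Eventually.of_forall fun z => ?_)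
      · refine HasRep.of_closure_squareIntegrablePart hp hM hz
          ((h _ ((hgb n).mono_exponent le_top)).2 ?_) ((hgb n).mono_exponent le_top)
        filter_upwards [hf0, hff'] with z h1 h2 hzE
        rw [← norm_le_zero_iff, ← norm_zero (E := ℂ), ← h1 hzE, h2]
        exact hgle n z
      · refine tendsto_const_nhds.congr' ?_
        filter_upwards [eventually_ge_atTop ⌈‖f' z‖⌉₊] with n hn
        have hn' : ‖f' z‖ ≤ n := (Nat.le_ceil _).trans (by exact_mod_cast hn)
        have hz' : z ∈ {z | ‖f' z‖ ≤ n} := hn'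
        simp only [g, Set.indicator_of_mem hz']
  · have hcm : Measurable fun z => conj (φ z) := Complex.continuous_conj.measurable.comp hφm
    have hc1 : ∀ z, ‖conj (φ z)‖ = 1 := fun z => by rw [RCLike.norm_conj, hφ]
    have hφφ : ∀ z, conj (φ z) * φ z = 1 := fun z => by rw [Complex.conj_mul', hφ]; simp
    refine Or.inr ⟨φ, hφm, hφ, fun f => ⟨fun hf => ?_, fun hf => ?_⟩⟩
    · obtain ⟨g, hgK, hgb, hgle, hlim⟩ := hf.exists_bounded_approx hp hM hz
      refine HasRep.of_dominated hp (isClosed_hardySubmodule p)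
        (f := fun n z => conj (φ z) * g n z) (fun n => ?_) hf.memLp.norm (fun n => ?_) ?_
      · refine hasRep_hardySubmodule_of_bounded hp (memLp_unimodular_mul hcm hc1 _ (hgb n)).1
          fun m => ?_
        rw [← (h _ ((hgb n).mono_exponent le_top)).1 (hgK n) m]
        congr 1
        ext z
        ring
      · filter_upwards [hgle n] with z h1
        rwa [norm_mul, hc1, one_mul]
      · filter_upwards [hlim] with z h1 using h1.const_mul _
    · have hφb : MemLp φ ∞ arc := memLp_top_of_bound hφm.aestronglyMeasurable 1
        (Eventually.of_forall fun z => (hφ z).le)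
      -- Being bounded, `φ` passes from the `L²`-closure to `M`. Then `φP ∈ M` for all polynomials
      -- `P`, and continuity of multiplication by `φ` extends this to `φH^p`.
      have hφM : HasRep M φ := by
        refine HasRep.of_closure_squareIntegrablePart hp hM hz
          ((h _ (hφb.mono_exponent le_top)).2 fun n => ?_) (hφb.mono_exponent le_top)
        have h1 := integral_zpow_arc (n := ((n + 1 : ℕ) : ℤ)) (by positivity)
        rw [← h1]
        congr 1
        ext z
        rw [mul_left_comm, hφφ, mul_one, zpow_natCast]
      obtain ⟨f', hf', hff⟩ := hf
      let T := unimodularMul p φ hφm hφ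
      have hT : T f' ∈ M := by
        have hcl : IsClosed {f | T f ∈ M} := hM.preimage T.continuous
        refine closure_minimal ?_ hcl hf'
        rintro q ⟨P, hP⟩
        refine HasRep.unimodularMul_mem.2 ((hφM.eval_mul hz P).congr ?_)
        filter_upwards [hP] with z h1
        rw [h1, mul_comm]
      refine (HasRep.unimodularMul_mem.1 hT).congr ?_
      filter_upwards [hff] with z h1
      rw [h1, ← mul_assoc, mul_comm (φ z), hφφ, one_mul]

-- Change of measure

section Weight

theorem measurable_densityRoot {p : ℝ≥0∞} {ν : Measure Circle} :
    Measurable (densityRoot p ν) := by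
  unfold densityRoot
  exact Complex.measurable_ofReal.comp
    ((Measure.measurable_rnDeriv ν arc).ennreal_toReal.pow_const _)

variable {p : ℝ≥0∞} [Fact (1 ≤ p)] {ν : Measure Circle} [IsProbabilityMeasure ν]

/-- The density is finite almost everywhere, so the `toReal` in `densityRoot` loses nothing. -/
theorem enorm_densityRoot_rpow (hp : p ≠ ∞) :
    ∀ᵐ z ∂arc, ‖densityRoot p ν z‖ₑ ^ p.toReal = ν.rnDeriv arc z := by
  have hpos : 0 < p.toReal :=
    ENNReal.toReal_pos (zero_lt_one.trans_le (Fact.out : 1 ≤ p)).ne' hp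
  filter_upwards [ν.rnDeriv_lt_top arc] with z hz
  have h1 : ‖densityRoot p ν z‖ₑ = ν.rnDeriv arc z ^ (1 / p.toReal) := by
    rw [densityRoot, ← ofReal_norm, Complex.norm_real,
      Real.norm_of_nonneg (by positivity),
      ← ENNReal.ofReal_rpow_of_nonneg ENNReal.toReal_nonneg (by positivity),
      ENNReal.ofReal_toReal hz.ne]
  rw [h1, ← ENNReal.rpow_mul, one_div_mul_cancel hpos.ne', ENNReal.rpow_one]

theorem densityRoot_ne_zero (hp : p ≠ ∞) (hν : ν ≪ arc) (hν' : arc ≪ ν) :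
    ∀ᵐ z ∂arc, densityRoot p ν z ≠ 0 := by
  have hpos : 0 < p.toReal :=
    ENNReal.toReal_pos (zero_lt_one.trans_le (Fact.out : 1 ≤ p)).ne' hp
  filter_upwards [enorm_densityRoot_rpow (ν := ν) hp, hν'.ae_le (Measure.rnDeriv_pos hν)]
    with z h1 h2 h3
  rw [h3, enorm_zero, ENNReal.zero_rpow_of_pos hpos] at h1
  exact h2.ne h1

theorem eLpNorm_densityRoot_mul (hp : p ≠ ∞) (hν : ν ≪ arc) {f : Circle → ℂ}
    (hf : AEStronglyMeasurable f arc) :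
    eLpNorm (fun z => densityRoot p ν z * f z) p arc = eLpNorm f p ν := by
  have hp0 : p ≠ 0 := (zero_lt_one.trans_le (Fact.out : 1 ≤ p)).ne'
  rw [eLpNorm_eq_lintegral_rpow_enorm_toReal hp0 hp, eLpNorm_eq_lintegral_rpow_enorm_toReal hp0 hp,
    ← lintegral_rnDeriv_mul hν (hf.enorm.pow_const _)]
  congr 1
  refine lintegral_congr_ae ?_
  filter_upwards [enorm_densityRoot_rpow (ν := ν) hp] with z hz
  rw [enorm_mul, ENNReal.mul_rpow_of_nonneg _ _ ENNReal.toReal_nonneg, hz]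

theorem memLp_inv_densityRoot_mul (hp : p ≠ ∞) (hν : ν ≪ arc) (hν' : arc ≪ ν) (f : Circle → ℂ)
    (hf : MemLp f p arc) :
    MemLp (fun z => (densityRoot p ν z)⁻¹ * f z) p ν ∧
      eLpNorm (fun z => (densityRoot p ν z)⁻¹ * f z) p ν = eLpNorm f p arc := by
  have hm : AEStronglyMeasurable (fun z => (densityRoot p ν z)⁻¹ * f z) arc :=
    measurable_densityRoot.inv.aestronglyMeasurable.mul hf.aestronglyMeasurable
  have h1 : eLpNorm (fun z => (densityRoot p ν z)⁻¹ * f z) p ν = eLpNorm f p arc := by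
    rw [← eLpNorm_densityRoot_mul hp hν hm]
    refine eLpNorm_congr_ae ?_
    filter_upwards [densityRoot_ne_zero hp hν hν'] with z hz
    rw [mul_inv_cancel_left₀ hz]
  exact ⟨⟨hm.mono_ac hν, h1 ▸ hf.2⟩, h1⟩

/-- The weighted image of a closed invariant subspace of `L^p(ν)` is a closed invariant subspace
of `L^p` with respect to arc length. -/
theorem exists_weighted_image (hp : p ≠ ∞) (hν : ν ≪ arc) (hν' : arc ≪ ν)
    (W : Submodule ℂ (Lp ℂ p ν)) (hW : IsClosed (W : Set (Lp ℂ p ν)))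
    (hz : ZInvariant (W : Set (Lp ℂ p ν))) :
    ∃ M : Submodule ℂ (Lp ℂ p arc), IsClosed (M : Set (Lp ℂ p arc)) ∧
      ZInvariant (M : Set (Lp ℂ p arc)) ∧
      ∀ h : Circle →ₘ[arc] ℂ,
        h ∈ mulImage arc (densityRoot p ν) (W : Set (Lp ℂ p ν)) ↔ HasRep M h := by
  -- `T` goes from `L^p(arc)` back to `L^p(ν)`, so the weighted image of `W` is a preimage under `T`
  -- and its closedness is immediate.
  let T := mulIsometry (fun z => (densityRoot p ν z)⁻¹) hν (memLp_inv_densityRoot_mul hp hν hν')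
  have hT : ∀ f, T f =ᵐ[ν] fun z => (densityRoot p ν z)⁻¹ * f z := fun f => coeFn_mulIsometry _ _ f
  let M : Submodule ℂ (Lp ℂ p arc) := W.comap T.toLinearMap
  have hmem : ∀ f, f ∈ M ↔ T f ∈ W := fun f => Submodule.mem_comap
  have hiff : ∀ h : Circle → ℂ, AEStronglyMeasurable h arc →
      ((∃ f ∈ W, ∀ᵐ z ∂arc, h z = densityRoot p ν z * f z) ↔ HasRep M h) := by
    intro h hm
    constructor
    · rintro ⟨f, hf, hfh⟩
      have hfm : AEStronglyMeasurable f arc := (Lp.aestronglyMeasurable f).mono_ac hν'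
      have hL : MemLp h p arc := by
        refine ⟨hm, ?_⟩
        rw [eLpNorm_congr_ae hfh, eLpNorm_densityRoot_mul hp hν hfm]
        exact (Lp.memLp f).2
      refine ⟨hL.toLp h, (hmem _).2 ?_, hL.coeFn_toLp⟩
      have : T (hL.toLp h) = f := by
        refine Lp.ext ?_
        filter_upwards [hT (hL.toLp h), hν.ae_le hL.coeFn_toLp, hν.ae_le hfh,
          hν.ae_le (densityRoot_ne_zero hp hν hν')] with z h1 h2 h3 h4
        rw [h1, h2, h3, inv_mul_cancel_left₀ h4]
      rwa [this]
    · rintro ⟨f, hf, hfh⟩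
      refine ⟨T f, (hmem f).1 hf, ?_⟩
      filter_upwards [hfh, hν'.ae_le (hT f), densityRoot_ne_zero hp hν hν'] with z h1 h2 h3
      rw [h2, mul_inv_cancel_left₀ h3, h1]
  refine ⟨M, hW.preimage T.continuous, fun f hf => ?_, fun h => hiff h h.aestronglyMeasurable⟩
  obtain ⟨g, hg, hgf⟩ := (hiff f (Lp.aestronglyMeasurable f)).2 (HasRep.of_mem hf)
  obtain ⟨k, hk, hkg⟩ := hz g hg
  exact (hiff (fun z => (z : ℂ) * f z) (measurable_coe_circle.aestronglyMeasurable.mul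
    (Lp.aestronglyMeasurable f))).1 ⟨k, hk, by
      filter_upwards [hgf, hν'.ae_le hkg] with z h1 h2
      rw [h1, h2, mul_left_comm]⟩

end Weight

end HardyCircle

end

-- The theorem for the weighted measure

/-- Closed `z`-invariant subspaces of `L^p(ν)`, for a probability measure `ν` on the circle that is
mutually absolutely continuous with normalized arc length. -/
theorem mainTheorem8 (ν : Measure Circle) [IsProbabilityMeasure ν]
    (hν : ν ≪ HardyCircle.arc) (hν' : HardyCircle.arc ≪ ν)
    (p : ℝ≥0∞) [Fact (1 ≤ p)] (hp : p ≠ ∞)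
    (W : Submodule ℂ (Lp ℂ p ν)) (hW : IsClosed (W : Set (Lp ℂ p ν)))
    (hz : HardyCircle.ZInvariant (W : Set (Lp ℂ p ν))) :
    (∃ E : Set Circle, MeasurableSet E ∧
      HardyCircle.mulImage HardyCircle.arc (HardyCircle.densityRoot p ν) (W : Set (Lp ℂ p ν)) =
        HardyCircle.mulImage HardyCircle.arc (E.indicator fun _ => (1 : ℂ))
          (Set.univ : Set (Lp ℂ p HardyCircle.arc))) ∨
    (∃ φ : Circle → ℂ, HardyCircle.Unimodular φ ∧
      HardyCircle.mulImage HardyCircle.arc (HardyCircle.densityRoot p ν) (W : Set (Lp ℂ p ν)) =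
        HardyCircle.mulImage HardyCircle.arc φ (HardyCircle.hardy p HardyCircle.arc)) := by
  obtain ⟨M, hM, hzM, hmem⟩ := HardyCircle.exists_weighted_image hp hν hν' W hW hz
  rcases HardyCircle.invariant_subspace hp hM hzM with ⟨E, hE, h⟩ | ⟨φ, hφm, hφ, h⟩
  · refine Or.inl ⟨E, hE, Set.ext fun f => ?_⟩
    rw [hmem, h]
    constructor
    · rintro ⟨hf, hf0⟩
      refine ⟨hf.toLp f, Set.mem_univ _, ?_⟩
      filter_upwards [hf0, hf.coeFn_toLp] with z h1 h2
      by_cases hzE : z ∈ E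
      · rw [Set.indicator_of_mem hzE, one_mul, h2]
      · rw [Set.indicator_of_notMem hzE, zero_mul, h1 hzE]
    · rintro ⟨g, -, hg⟩
      refine ⟨(Lp.memLp g).of_le f.aestronglyMeasurable ?_, ?_⟩
      · filter_upwards [hg] with z h1
        rw [h1]
        by_cases hzE : z ∈ E <;> simp [hzE]
      · filter_upwards [hg] with z h1 hzE
        rw [h1, Set.indicator_of_notMem hzE, zero_mul]
  · refine Or.inr ⟨φ, ⟨hφm, Filter.Eventually.of_forall hφ⟩, Set.ext fun f => ?_⟩
    have hφφ : ∀ z, φ z * (starRingEnd ℂ) (φ z) = 1 := fun z => by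
      rw [Complex.mul_conj', hφ]; simp
    rw [hmem, h]
    constructor
    · rintro ⟨g, hg, hgf⟩
      refine ⟨g, hg, ?_⟩
      filter_upwards [hgf] with z h1
      rw [h1, ← mul_assoc, hφφ, one_mul]
    · rintro ⟨g, hg, hgf⟩
      refine ⟨g, hg, ?_⟩
      filter_upwards [hgf] with z h1
      rw [h1, ← mul_assoc, mul_comm ((starRingEnd ℂ) (φ z)), hφφ, one_mul]
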